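/- Let $L$ be a finite-dimensional Lie algebra over a field $F$. A chief factor $X/Y$ of $L$ consists of ideals $Y\subset X$ of $L$ such that $X/Y$ is a minimal ideal of $L/Y$. It is supplemented by a proper subalgebra $M$ of $L$ if $L=X+M$ and $Y\subseteq X\cap M$, and it is supplemented if such an $M$ exists. Two ideals of quotients of $L$ (for instance two chief factors of $L$) are $L$-isomorphic if there is a Lie algebra isomorphism between them which commutes with the action of $L$. Two chief factors of $L$ are $L$-connected if they are $L$-isomorphic, or if $L$ has an epimorphic image $\bar L$ which has a maximal subalgebra containing no nonzero ideal of $\bar L$, which has exactly two minimal ideals, both nonabelian, and whose two minimal ideals are $L$-isomorphic, respectively, to the two given factors. Let $A/B$ be a supplemented chief factor of $L$. Put $C=A+C_L(A/B)$, where $C_L(A/B)=\{x\in L:[x,A]\subseteq B\}$, and let $R$ be the intersection of the cores $M_L$ (the largest ideal of $L$ contained in $M$), taken over all maximal subalgebras $M$ of $L$ that supplement some chief factor of $L$ which is $L$-connected to $A/B$. Then $R\subseteq C$ and $C/R=\mathrm{Soc}(L/R)$, the sum of all minimal ideals of $L/R$. Furthermore: (i) every minimal ideal $I/R$ of $L/R$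 is a supplemented chief factor of $L$ which is $L$-connected to $A/B$; (ii) no supplemented chief factor $X/Y$ of $L$ with $C\subseteq Y$ or $X\subseteq R$ is $L$-connected to $A/B$. Moreover, there are $r$ ideals $A_1,\ldots,A_r$ of $L$ containing $R$ such that \[ C/R = A_1/R\oplus\cdots\oplus A_r/R, \] where each $A_i/R$ is a supplemented chief factor of $L$ which is $L$-connected to $A/B$, and $r$ is the number of supplemented chief factors $L$-connected to $A/B$ in each chief series $0=S_0<S_1<\cdots<S_n=L$ of $L$. Finally, $\phi(L/R)=0$, where $\phi$ denotes the Frattini ideal, that is, the largest ideal contained in the intersection of all maximal subalgebras. -/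

import Mathlib

namespace LieCrown

section

variable {F L : Type*} [Field F] [LieRing L] [LieAlgebra F L]

/-- The canonical projection `L → L/K` as a homomorphism of Lie algebras. -/
def proj (K : LieIdeal F L) : L →ₗ⁅F⁆ L ⧸ K :=
  { K.toSubmodule.mkQ with
    map_lie' := fun {x y} => LieSubmodule.Quotient.mk_bracket K x y }

/-- `A/B`, as an ideal of `L/B` (meaningful for `B ≤ A`). -/
def factor (A B : LieIdeal F L) : LieIdeal F (L ⧸ B) :=
  LieIdeal.map (proj B) A

/-- The core `U_L` of a subalgebra `U`: the largest ideal of `L` contained in `U`. -/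
def core (U : LieSubalgebra F L) : LieIdeal F L :=
  sSup {I : LieIdeal F L | I.toLieSubalgebra ≤ U}

theorem core_isGreatest (U : LieSubalgebra F L) :
    IsGreatest {I : LieIdeal F L | I.toLieSubalgebra ≤ U} (core U) := by
  refine ⟨?_, fun I hI => le_sSup hI⟩
  have h : (core U).toSubmodule ≤ U.toSubmodule := by
    rw [core, LieSubmodule.sSup_toSubmodule]
    refine sSup_le ?_
    rintro _ ⟨I, hI, rfl⟩
    exact hI
  exact h

/-- The Frattini ideal `φ(L)`: the core of the intersection of all maximal subalgebras. -/
def frattini (F L : Type*) [Field F] [LieRing L] [LieAlgebra F L] : LieIdeal F L :=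
  core (sInf {M : LieSubalgebra F L | IsCoatom M})

/-- The socle: the sum of all minimal ideals. -/
def socle (F L : Type*) [Field F] [LieRing L] [LieAlgebra F L] : LieIdeal F L :=
  sSup {I : LieIdeal F L | IsAtom I}

/-- `L` is primitive: it has a core-free maximal subalgebra. -/
def IsPrimitive (F L : Type*) [Field F] [LieRing L] [LieAlgebra F L] : Prop :=
  ∃ M : LieSubalgebra F L, IsCoatom M ∧ core M = ⊥

/-- `L` is primitive of type 3: primitive with precisely two minimal ideals, both nonabelian. -/
def IsPrimitiveType3 (F L : Type*) [Field F] [LieRing L] [LieAlgebra F L] : Prop :=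
  IsPrimitive F L ∧ {P : LieIdeal F L | IsAtom P}.ncard = 2 ∧
    ∀ P : LieIdeal F L, IsAtom P → ¬ IsLieAbelian P

/-- The centraliser `C_L(A/B)` of a factor, `{x ∈ L : [x, A] ⊆ B}`. -/
def centraliser (A B : LieIdeal F L) : LieIdeal F L where
  carrier := {x | ∀ a ∈ A, ⁅x, a⁆ ∈ B}
  add_mem' := fun {x y} hx hy a ha => by
    rw [add_lie]
    exact add_mem (hx a ha) (hy a ha)
  zero_mem' := fun a _ => by
    rw [zero_lie]
    exact zero_mem B
  smul_mem' := fun c x hx a ha => by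
    rw [smul_lie]
    exact B.smul_mem c (hx a ha)
  lie_mem := fun {y x} hx a ha => by
    rw [lie_lie]
    exact sub_mem (B.lie_mem (hx a ha)) (hx _ (A.lie_mem ha))

/-- `A/B` is a chief factor of `L`: `A/B` is a minimal ideal of `L/B`. -/
def IsChiefFactor (A B : LieIdeal F L) : Prop :=
  B ≤ A ∧ IsAtom (factor A B)

/-- `M` is a (proper) supplement of `A/B` in `L`: `L = A + M` and `B ⊆ A ∩ M`. -/
def IsSupplement (M : LieSubalgebra F L) (A B : LieIdeal F L) : Prop :=
  M ≠ ⊤ ∧ A.toSubmodule ⊔ M.toSubmodule = ⊤ ∧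
    B.toSubmodule ≤ A.toSubmodule ⊓ M.toSubmodule

/-- `A/B` is a supplemented chief factor of `L`. -/
def IsSupplementedChiefFactor (A B : LieIdeal F L) : Prop :=
  IsChiefFactor A B ∧ ∃ M : LieSubalgebra F L, IsSupplement M A B

/-- `L`-isomorphism between ideals `P` of `L/B` and `Q` of `L/E`: an isomorphism of Lie algebras
commuting with the actions of `L` induced by its adjoint action. -/
def LIso {B E : LieIdeal F L} (P : LieIdeal F (L ⧸ B)) (Q : LieIdeal F (L ⧸ E)) : Prop :=
  ∃ e : P ≃ₗ⁅F⁆ Q, ∀ (x : L) (p : P), e ⁅proj B x, p⁆ = ⁅proj E x, e p⁆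

/-- The factors `A/B` and `D/E` are `L`-connected: they are `L`-isomorphic, or some epimorphic
image of `L` (up to isomorphism, some `L/K`) is primitive of type 3 and its two minimal ideals
are `L`-isomorphic to `A/B` and `D/E` respectively. -/
def LConnected (A B D E : LieIdeal F L) : Prop :=
  LIso (factor A B) (factor D E) ∨
    ∃ K : LieIdeal F L, IsPrimitiveType3 F (L ⧸ K) ∧
      ∃ P Q : LieIdeal F (L ⧸ K), IsAtom P ∧ IsAtom Q ∧ P ≠ Q ∧
        LIso (factor A B) P ∧ LIso (factor D E) Q

/-- The family `J` of the cores `M_L` of the maximal subalgebras `M` of `L` that supplement some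
chief factor of `L` which is `L`-connected to `A/B`. -/
def crownFamily (A B : LieIdeal F L) : Set (LieIdeal F L) :=
  {N | ∃ M : LieSubalgebra F L, IsCoatom M ∧
    (∃ X Y : LieIdeal F L, IsChiefFactor X Y ∧ LConnected X Y A B ∧ IsSupplement M X Y) ∧
    N = core M}

/-- The ideal `R` of the crown `C/R` associated with `A/B`. -/
def crownBot (A B : LieIdeal F L) : LieIdeal F L :=
  sInf (crownFamily A B)

/-- The ideal `C = A + C_L(A/B)` of the crown `C/R` associated with `A/B`. -/
def crownTop (A B : LieIdeal F L) : LieIdeal F L :=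
  A ⊔ centraliser A B

/-- `0 = S 0 < S 1 < ⋯ < S n = L` is a chief series of `L`. -/
def IsChiefSeries (n : ℕ) (S : Fin (n + 1) → LieIdeal F L) : Prop :=
  S 0 = ⊥ ∧ S (Fin.last n) = ⊤ ∧ ∀ i : Fin n, IsChiefFactor (S i.succ) (S i.castSucc)

end

end LieCrown

namespace LieCrown

section

variable {F L : Type*} [Field F] [LieRing L] [LieAlgebra F L]

/-! Chief factors are the covers `Y ⋖ X` in the modular lattice of ideals, and an ideal `K` with `X
⊓ K ≤ Y` centralises `X/Y`. The proof rests on a description of `R` from above: `R` is the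
intersection of the ideals `N ⋖ C` containing `R` with `C/N` connected to `A/B` (`crownCoatoms`).
Indeed, let `M` be a maximal supplement of `X/Y`. If `X/Y` is abelian, then `C_L(X/Y) = X + M_L`
(`centraliser_eq_sup_core`) and `M_L` is itself such an `N`. If not, `M_L` is either `C_L(X/Y)` or
the intersection of `C_L(X/Y)` and `X + M_L`, both covered by the crown top
(`core_of_not_le_centraliser`).

This uses transitivity of connectedness, which the definition hides, since two different primitive
quotients may be involved. For nonabelian factors it is recast (`lConnected_iff_link`) as equality
of the tops `T = X + C_L(X/Y)` together with an isomorphism between the quotients by the two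
centralisers which is the identity on `L/T`. `Link` encodes such an isomorphism by a subalgebra, and
`Link.trans` composes them.

A minimal choice and the modular law then complement every ideal between `R` and `C`
(`exists_complement`). Minimal ideals of `L/R` lie in `C/R`, because an ideal meeting `C` inside `N`
centralises `C/N`. Hence `C/R` is the socle.

For the count, `dim ((S i ∩ C) + R)` climbs from `dim R` to `dim C` along a chief series, by `dim
A/B` exactly at the supplemented connected factors (`finrank_step`). A rise at `X/Y` yields some `N`
with `X ⊓ N = Y` and `X ⊔ N = C`, so that `X/Y` is isomorphic to `C/N`, which is supplemented
(`exists_supplement_crownCoatom`). -/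

/-! ### Ideals of quotients and covers in the lattice of ideals. -/

theorem proj_surjective (K : LieIdeal F L) : Function.Surjective (proj K) :=
  LieSubmodule.Quotient.surjective_mk' K

theorem proj_eq_zero {K : LieIdeal F L} {x : L} : proj K x = 0 ↔ x ∈ K :=
  LieSubmodule.Quotient.mk_eq_zero'

theorem proj_eq_proj {K : LieIdeal F L} {x y : L} : proj K x = proj K y ↔ x - y ∈ K := by
  rw [← sub_eq_zero, ← map_sub, proj_eq_zero]

theorem mem_factor {A B : LieIdeal F L} {p : L ⧸ B} : p ∈ factor A B ↔ ∃ a ∈ A, proj B a = p := by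
  constructor
  · intro h
    obtain ⟨a, ha⟩ := LieIdeal.mem_map_of_surjective (proj_surjective B) h
    exact ⟨a, a.2, ha⟩
  · rintro ⟨a, ha, rfl⟩
    exact LieIdeal.mem_map ha

theorem le_comap_proj {B : LieIdeal F L} (P : LieIdeal F (L ⧸ B)) :
    B ≤ LieIdeal.comap (proj B) P := fun x hx => by
  rw [LieIdeal.mem_comap, proj_eq_zero.2 hx]
  exact zero_mem P

theorem comap_factor {A B : LieIdeal F L} (h : B ≤ A) :
    LieIdeal.comap (proj B) (factor A B) = A := by
  ext x
  rw [LieIdeal.mem_comap, mem_factor]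
  constructor
  · rintro ⟨a, ha, hx⟩
    have := h (proj_eq_proj.1 hx)
    have h2 := sub_mem ha this
    rwa [sub_sub_cancel] at h2
  · intro hx
    exact ⟨x, hx, rfl⟩

theorem factor_comap {B : LieIdeal F L} (P : LieIdeal F (L ⧸ B)) :
    factor (LieIdeal.comap (proj B) P) B = P := by
  ext p
  rw [mem_factor]
  constructor
  · rintro ⟨a, ha, rfl⟩
    exact ha
  · intro hp
    obtain ⟨x, rfl⟩ := proj_surjective B p
    exact ⟨x, hp, rfl⟩

theorem comap_proj_le_iff {B : LieIdeal F L} {P Q : LieIdeal F (L ⧸ B)} :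
    LieIdeal.comap (proj B) P ≤ LieIdeal.comap (proj B) Q ↔ P ≤ Q := by
  refine ⟨fun h => ?_, fun h => LieIdeal.comap_mono h⟩
  rw [← factor_comap P, ← factor_comap Q]
  exact LieIdeal.map_mono h

theorem factor_mono {A A' B : LieIdeal F L} (h : A ≤ A') : factor A B ≤ factor A' B :=
  LieIdeal.map_mono h

theorem comap_proj_bot (B : LieIdeal F L) : LieIdeal.comap (proj B) ⊥ = B := by
  ext x
  rw [LieIdeal.mem_comap, LieSubmodule.mem_bot, proj_eq_zero]

/-- Moves minimality from a quotient to the ideal lattice of `L`, where factors over different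
ideals can be compared. -/
theorem isAtom_iff_covBy {B : LieIdeal F L} {P : LieIdeal F (L ⧸ B)} :
    IsAtom P ↔ B ⋖ LieIdeal.comap (proj B) P := by
  rw [← bot_covBy_iff]
  constructor
  · intro h
    refine ⟨?_, fun J hJ hJP => ?_⟩
    · rw [lt_iff_le_not_ge]
      refine ⟨le_comap_proj P, fun h' => h.1.not_ge ?_⟩
      rw [← comap_proj_le_iff, comap_proj_bot]
      exact h'
    · have hle := hJ.le
      rw [← comap_factor hle] at hJ hJP
      rw [lt_iff_le_not_ge, comap_proj_le_iff, comap_proj_le_iff, ← lt_iff_le_not_ge] at hJP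
      refine h.2 ?_ hJP
      rw [bot_lt_iff_ne_bot]
      intro h0
      rw [h0, comap_proj_bot] at hJ
      exact hJ.ne rfl
  · intro h
    refine ⟨?_, fun J hJ hJP => ?_⟩
    · rw [bot_lt_iff_ne_bot]
      rintro rfl
      rw [comap_proj_bot] at h
      exact h.1.ne rfl
    · refine h.2 (c := LieIdeal.comap (proj B) J) ?_ ?_
      · rw [lt_iff_le_not_ge]
        refine ⟨le_comap_proj J, fun h' => hJ.not_ge ?_⟩
        rw [← comap_proj_le_iff, comap_proj_bot]
        exact h'
      · rwa [lt_iff_le_not_ge, comap_proj_le_iff, comap_proj_le_iff, ← lt_iff_le_not_ge]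

theorem isChiefFactor_iff {A B : LieIdeal F L} : IsChiefFactor A B ↔ B ⋖ A := by
  constructor
  · rintro ⟨h, h'⟩
    rwa [isAtom_iff_covBy, comap_factor h] at h'
  · intro h
    refine ⟨h.le, ?_⟩
    rwa [isAtom_iff_covBy, comap_factor h.le]

theorem mem_centraliser {A B : LieIdeal F L} {x : L} :
    x ∈ centraliser A B ↔ ∀ a ∈ A, ⁅x, a⁆ ∈ B := Iff.rfl

/-! ### `L`-isomorphisms and their invariants. -/

theorem LIso.refl {B : LieIdeal F L} (P : LieIdeal F (L ⧸ B)) : LIso P P :=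
  ⟨LieEquiv.refl, fun _ _ => rfl⟩

theorem LIso.symm {B E : LieIdeal F L} {P : LieIdeal F (L ⧸ B)} {Q : LieIdeal F (L ⧸ E)}
    (h : LIso P Q) : LIso Q P := by
  obtain ⟨e, he⟩ := h
  refine ⟨e.symm, fun x q => ?_⟩
  apply e.injective
  change e (e.symm _) = e _
  rw [he, LieEquiv.apply_symm_apply, LieEquiv.apply_symm_apply]

theorem LIso.trans {B E G : LieIdeal F L} {P : LieIdeal F (L ⧸ B)} {Q : LieIdeal F (L ⧸ E)}
    {S : LieIdeal F (L ⧸ G)} (h : LIso P Q) (h' : LIso Q S) : LIso P S := by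
  obtain ⟨e, he⟩ := h
  obtain ⟨e', he'⟩ := h'
  refine ⟨e.trans e', fun x q => ?_⟩
  rw [LieEquiv.trans_apply, LieEquiv.trans_apply, he, he']

/-- The map `L/Y → L/N` induced by an inclusion of ideals. -/
def quotMap {Y N : LieIdeal F L} (h : Y ≤ N) : L ⧸ Y →ₗ⁅F⁆ L ⧸ N :=
  { Submodule.mapQ Y.toSubmodule N.toSubmodule LinearMap.id (by simpa using h) with
    map_lie' := fun {x y} => by
      obtain ⟨x, rfl⟩ := proj_surjective Y x
      obtain ⟨y, rfl⟩ := proj_surjective Y y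
      exact (proj N).map_lie x y }

/-- The second isomorphism theorem for factors of `L`. -/
theorem LIso.of_inf_sup {X Y N T : LieIdeal F L} (h : X ⊓ N = Y) (h' : X ⊔ N = T) :
    LIso (factor X Y) (factor T N) := by
  have hYN : Y ≤ N := h ▸ inf_le_right
  have hm : ∀ p : factor X Y, quotMap hYN (p : L ⧸ Y) ∈ factor T N := by
    rintro ⟨p, hp⟩
    obtain ⟨x, hx, rfl⟩ := mem_factor.1 hp
    exact mem_factor.2 ⟨x, h' ▸ (le_sup_left : X ≤ X ⊔ N) hx, rfl⟩
  let g : factor X Y →ₗ⁅F⁆ factor T N :=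
    { toFun := fun p => ⟨quotMap hYN p, hm p⟩
      map_add' := fun p q => by ext; exact (quotMap hYN).map_add _ _
      map_smul' := fun c p => by ext; exact (quotMap hYN).map_smul _ _
      map_lie' := fun {p q} => by ext; exact (quotMap hYN).map_lie _ _ }
  have hinj : Function.Injective g := by
    intro p q hpq
    obtain ⟨p, hp⟩ := p
    obtain ⟨q, hq⟩ := q
    obtain ⟨x, hx, rfl⟩ := mem_factor.1 hp
    obtain ⟨y, hy, rfl⟩ := mem_factor.1 hq
    have h1 : proj N x = proj N y := congrArg Subtype.val hpq
    rw [proj_eq_proj] at h1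
    have h2 : x - y ∈ X ⊓ N := ⟨sub_mem hx hy, h1⟩
    rw [h] at h2
    exact Subtype.ext (proj_eq_proj.2 h2)
  have hsurj : Function.Surjective g := by
    rintro ⟨p, hp⟩
    obtain ⟨t, ht, rfl⟩ := mem_factor.1 hp
    rw [← h', LieSubmodule.mem_sup] at ht
    obtain ⟨x, hx, n, hn, rfl⟩ := ht
    refine ⟨⟨proj Y x, mem_factor.2 ⟨x, hx, rfl⟩⟩, ?_⟩
    apply Subtype.ext
    change proj N x = proj N (x + n)
    rw [proj_eq_proj, sub_add_cancel_left]
    exact neg_mem hn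
  refine ⟨{ g with
    invFun := (Equiv.ofBijective g ⟨hinj, hsurj⟩).symm
    left_inv := (Equiv.ofBijective g ⟨hinj, hsurj⟩).left_inv
    right_inv := (Equiv.ofBijective g ⟨hinj, hsurj⟩).right_inv }, fun x p => ?_⟩
  obtain ⟨p, hp⟩ := p
  obtain ⟨y, hy, rfl⟩ := mem_factor.1 hp
  apply Subtype.ext
  exact (quotMap hYN).map_lie (proj Y x) (proj Y y)

theorem mem_centraliser_iff_factor {A B : LieIdeal F L} {x : L} :
    x ∈ centraliser A B ↔ ∀ p : factor A B, ⁅proj B x, p⁆ = 0 := by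
  rw [mem_centraliser]
  constructor
  · rintro h ⟨p, hp⟩
    obtain ⟨a, ha, rfl⟩ := mem_factor.1 hp
    apply Subtype.ext
    change ⁅proj B x, proj B a⁆ = 0
    rw [← LieHom.map_lie, proj_eq_zero]
    exact h a ha
  · intro h a ha
    have h1 : ⁅proj B x, proj B a⁆ = 0 :=
      congrArg Subtype.val (h ⟨proj B a, mem_factor.2 ⟨a, ha, rfl⟩⟩)
    rwa [← LieHom.map_lie, proj_eq_zero] at h1

theorem LIso.centraliser_eq {A B D E : LieIdeal F L} (h : LIso (factor A B) (factor D E)) :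
    centraliser A B = centraliser D E := by
  obtain ⟨e, he⟩ := h
  ext x
  rw [mem_centraliser_iff_factor, mem_centraliser_iff_factor]
  constructor
  · intro h q
    obtain ⟨p, rfl⟩ : ∃ p, e p = q := ⟨e.symm q, e.apply_symm_apply q⟩
    rw [← he, h p]
    exact e.toLieHom.map_zero
  · intro h p
    apply e.injective
    change e _ = e _
    rw [he, h]
    exact e.toLieHom.map_zero.symm

theorem isLieAbelian_factor_iff {A B : LieIdeal F L} :
    IsLieAbelian (factor A B) ↔ A ≤ centraliser A B := by
  constructor
  · intro h a ha b hb
    have h1 : ⁅proj B a, proj B b⁆ = 0 :=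
      congrArg Subtype.val (h.trivial ⟨proj B a, mem_factor.2 ⟨a, ha, rfl⟩⟩
        ⟨proj B b, mem_factor.2 ⟨b, hb, rfl⟩⟩)
    rwa [← LieHom.map_lie, proj_eq_zero] at h1
  · intro h
    refine ⟨?_⟩
    rintro ⟨p, hp⟩ ⟨q, hq⟩
    obtain ⟨a, ha, rfl⟩ := mem_factor.1 hp
    obtain ⟨b, hb, rfl⟩ := mem_factor.1 hq
    apply Subtype.ext
    change ⁅proj B a, proj B b⁆ = 0
    rw [← LieHom.map_lie, proj_eq_zero]
    exact h ha b hb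

theorem LIso.isLieAbelian_iff {B E : LieIdeal F L} {P : LieIdeal F (L ⧸ B)}
    {Q : LieIdeal F (L ⧸ E)} (h : LIso P Q) : IsLieAbelian P ↔ IsLieAbelian Q := by
  obtain ⟨e, -⟩ := h
  exact lie_abelian_iff_equiv_lie_abelian e

theorem LIso.finrank_eq {B E : LieIdeal F L} {P : LieIdeal F (L ⧸ B)}
    {Q : LieIdeal F (L ⧸ E)} (h : LIso P Q) : Module.finrank F P = Module.finrank F Q := by
  obtain ⟨e, -⟩ := h
  exact e.toLinearEquiv.finrank_eq

theorem finrank_factor_add [FiniteDimensional F L] {A B : LieIdeal F L} (h : B ≤ A) :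
    Module.finrank F (factor A B) + Module.finrank F B = Module.finrank F A := by
  have h1 : LinearMap.range (B.toSubmodule.mkQ.domRestrict A.toSubmodule) =
      (factor A B).toSubmodule := by
    rw [LinearMap.range_domRestrict]
    ext p
    exact mem_factor.symm
  have h2 := (B.toSubmodule.mkQ.domRestrict A.toSubmodule).finrank_range_add_finrank_ker
  rw [h1, LinearMap.ker_domRestrict, Submodule.ker_mkQ] at h2
  have h3 := (Submodule.comapSubtypeEquivOfLe
    (show B.toSubmodule ≤ A.toSubmodule from h)).finrank_eq
  rw [h3] at h2
  exact h2

/-! ### Cores and supplements. -/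

theorem mem_of_mem_core {M : LieSubalgebra F L} {x : L} (h : x ∈ core M) : x ∈ M :=
  (core_isGreatest M).1 h

theorem le_core {M : LieSubalgebra F L} {I : LieIdeal F L} (h : ∀ x ∈ I, x ∈ M) : I ≤ core M :=
  (core_isGreatest M).2 h

theorem exists_add_eq {X : LieIdeal F L} {M : LieSubalgebra F L}
    (h : X.toSubmodule ⊔ M.toSubmodule = ⊤) (l : L) : ∃ x ∈ X, ∃ m ∈ M, x + m = l :=
  Submodule.mem_sup.1 (h ▸ Submodule.mem_top : l ∈ X.toSubmodule ⊔ M.toSubmodule)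

theorem sup_eq_top_of_forall {X : LieIdeal F L} {M : LieSubalgebra F L}
    (h : ∀ l : L, ∃ x ∈ X, ∃ m ∈ M, x + m = l) : X.toSubmodule ⊔ M.toSubmodule = ⊤ :=
  eq_top_iff.2 fun l _ => Submodule.mem_sup.2 (h l)

theorem eq_top_of_sup_of_le {X : LieIdeal F L} {M : LieSubalgebra F L}
    (h : X.toSubmodule ⊔ M.toSubmodule = ⊤) (h' : ∀ x ∈ X, x ∈ M) : M = ⊤ := by
  rw [eq_top_iff]
  intro l _
  obtain ⟨x, hx, m, hm, rfl⟩ := exists_add_eq h l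
  exact add_mem (h' x hx) hm

/-- If `L = X + M` and `X` normalises `M ∩ D` for an ideal `D`, then `M ∩ D` is an ideal. -/
theorem inf_le_core {M : LieSubalgebra F L} {D X : LieIdeal F L}
    (hX : X.toSubmodule ⊔ M.toSubmodule = ⊤) (h : ∀ x ∈ X, ∀ w ∈ M, w ∈ D → ⁅x, w⁆ ∈ M)
    {w : L} (hw : w ∈ M) (hwD : w ∈ D) : w ∈ core M := by
  let I : LieIdeal F L :=
    { M.toSubmodule ⊓ D.toSubmodule with
      lie_mem := by
        rintro l w ⟨hw, hwD⟩
        obtain ⟨x, hx, m, hm, rfl⟩ := exists_add_eq hX l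
        refine ⟨?_, D.lie_mem hwD⟩
        change ⁅x + m, w⁆ ∈ M
        rw [add_lie]
        exact add_mem (h x hx w hw hwD) (M.lie_mem hm hw) }
  have : I ≤ core M := le_core fun x hx => hx.1
  exact this ⟨hw, hwD⟩

/-- The sum of a subalgebra and an ideal, as a subalgebra. -/
def supIdeal (U : LieSubalgebra F L) (N : LieIdeal F L) : LieSubalgebra F L :=
  { N.toSubmodule ⊔ U.toSubmodule with
    lie_mem' := by
      intro a b ha hb
      obtain ⟨n, hn, u, hu, rfl⟩ := Submodule.mem_sup.1 ha
      obtain ⟨n', hn', u', hu', rfl⟩ := Submodule.mem_sup.1 hb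
      refine Submodule.mem_sup.2 ⟨⁅n, n' + u'⁆ + ⁅u, n'⁆, ?_, ⁅u, u'⁆, U.lie_mem hu hu', ?_⟩
      · exact add_mem (lie_mem_left F L N _ _ hn) (N.lie_mem hn')
      · rw [add_lie, lie_add u, add_assoc] }

theorem mem_supIdeal {U : LieSubalgebra F L} {N : LieIdeal F L} {x : L} :
    x ∈ supIdeal U N ↔ ∃ n ∈ N, ∃ u ∈ U, n + u = x := Submodule.mem_sup

theorem le_supIdeal (U : LieSubalgebra F L) (N : LieIdeal F L) : U ≤ supIdeal U N :=
  fun u hu => mem_supIdeal.2 ⟨0, zero_mem N, u, hu, zero_add u⟩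

theorem mem_supIdeal_of_mem {U : LieSubalgebra F L} {N : LieIdeal F L} {x : L} (h : x ∈ N) :
    x ∈ supIdeal U N :=
  mem_supIdeal.2 ⟨x, h, 0, zero_mem U, add_zero x⟩

theorem sup_eq_top_of_isCoatom {M : LieSubalgebra F L} (hM : IsCoatom M) {J : LieIdeal F L}
    (h : ¬ J ≤ core M) : J.toSubmodule ⊔ M.toSubmodule = ⊤ := by
  have h1 : supIdeal M J = ⊤ := by
    refine hM.2 _ (lt_of_le_of_ne (le_supIdeal M J) fun h2 => h (le_core fun x hx => ?_))
    rw [h2]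
    exact mem_supIdeal_of_mem hx
  refine sup_eq_top_of_forall fun l => mem_supIdeal.1 ?_
  rw [h1]
  exact LieSubalgebra.mem_top l

theorem IsSupplement.exists_isCoatom [FiniteDimensional F L] {M : LieSubalgebra F L}
    {X Y : LieIdeal F L} (h : IsSupplement M X Y) :
    ∃ M' : LieSubalgebra F L, IsCoatom M' ∧ IsSupplement M' X Y := by
  obtain ⟨M', hM', hle⟩ := (eq_top_or_exists_le_coatom M).resolve_left h.1
  refine ⟨M', hM', hM'.1, eq_top_iff.2 ?_, h.2.2.trans (inf_le_inf_left _ hle)⟩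
  rw [← h.2.1]
  exact sup_le_sup le_rfl hle

theorem isSupplement_of_isCoatom {M : LieSubalgebra F L} (hM : IsCoatom M) {X Y : LieIdeal F L}
    (hYX : Y ≤ X) (hY : Y ≤ core M) (h : ¬ X ≤ core M) : IsSupplement M X Y :=
  ⟨hM.1, sup_eq_top_of_isCoatom hM h, le_inf hYX fun _ hx => mem_of_mem_core (hY hx)⟩

theorem IsSupplement.le_core {M : LieSubalgebra F L} {X Y : LieIdeal F L}
    (h : IsSupplement M X Y) : Y ≤ core M :=
  LieCrown.le_core fun _ hx => (h.2.2 hx).2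

theorem IsSupplement.not_le_core {M : LieSubalgebra F L} {X Y : LieIdeal F L}
    (h : IsSupplement M X Y) : ¬ X ≤ core M := fun h' =>
  h.1 (eq_top_of_sup_of_le h.2.1 fun _ hx => mem_of_mem_core (h' hx))

theorem inf_eq_of_covBy {X Y K : LieIdeal F L} (h : Y ⋖ X) (hY : Y ≤ K) (hX : ¬ X ≤ K) :
    X ⊓ K = Y :=
  (h.eq_or_eq (le_inf h.le hY) inf_le_left).resolve_right fun h' => hX (inf_eq_left.1 h')

theorem le_centraliser_of_inf_le {X Y K : LieIdeal F L} (h : X ⊓ K ≤ Y) : K ≤ centraliser X Y :=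
  fun _ hk _ hx => h ⟨X.lie_mem hx, lie_mem_left F L K _ _ hk⟩

theorem le_centraliser_self (X Y : LieIdeal F L) : Y ≤ centraliser X Y :=
  le_centraliser_of_inf_le inf_le_right

/-- For an abelian chief factor the crown top is the centraliser. -/
theorem centraliser_eq_sup_core {M : LieSubalgebra F L} {X Y : LieIdeal F L} (hXY : Y ⋖ X)
    (h : IsSupplement M X Y) (hab : X ≤ centraliser X Y) : centraliser X Y = X ⊔ core M := by
  refine le_antisymm (fun c hc => ?_) (sup_le hab (le_centraliser_of_inf_le
    (inf_eq_of_covBy hXY h.le_core h.not_le_core).le))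
  obtain ⟨x, hx, m, hm, rfl⟩ := exists_add_eq h.2.1 c
  rw [LieSubmodule.mem_sup]
  refine ⟨x, hx, m, inf_le_core (D := centraliser X Y) h.2.1 (fun y hy w _ hwC => ?_) hm ?_, rfl⟩
  -- `[X, C_L(X/Y)] ⊆ Y ⊆ M`, so `X` normalises `M ∩ C_L(X/Y)`, which therefore lies in the core.
  · rw [← lie_skew]
    exact neg_mem (h.2.2 (hwC y hy)).2
  · have := sub_mem hc (hab hx)
    rwa [add_sub_cancel_left] at this

/-! ### Links: isomorphisms between quotients, encoded by subalgebras. -/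

/-- `L/N₁` and `L/N₂` are identified by a common supplement `U` that meets both ideals in
their intersection. -/
def Link (N₁ N₂ : LieIdeal F L) : Prop :=
  ∃ U : LieSubalgebra F L, N₁.toSubmodule ⊔ U.toSubmodule = ⊤ ∧
    N₂.toSubmodule ⊔ U.toSubmodule = ⊤ ∧ (∀ x ∈ U, x ∈ N₁ ↔ x ∈ N₂) ∧
    ∀ x ∈ N₁, x ∈ N₂ → x ∈ U

theorem Link.refl (N : LieIdeal F L) : Link N N :=
  ⟨⊤, by simp, by simp, fun _ _ => Iff.rfl, fun _ _ _ => LieSubalgebra.mem_top _⟩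

theorem Link.symm {N₁ N₂ : LieIdeal F L} (h : Link N₁ N₂) : Link N₂ N₁ := by
  obtain ⟨U, h1, h2, h3, h4⟩ := h
  exact ⟨U, h2, h1, fun x hx => (h3 x hx).symm, fun x hx hx' => h4 x hx' hx⟩

theorem lie_sub_lie_mem {N : LieIdeal F L} {a b c d : L} (h : a - c ∈ N) (h' : b - d ∈ N) :
    ⁅a, b⁆ - ⁅c, d⁆ ∈ N := by
  have : ⁅a, b⁆ - ⁅c, d⁆ = ⁅a - c, b⁆ + ⁅c, b - d⁆ := by
    rw [sub_lie, lie_sub]; abel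
  rw [this]
  exact add_mem (lie_mem_left F L N _ _ h) (N.lie_mem h')

/-- The composite of two links, as a subalgebra. -/
def linkComp (N₁ N₂ N₃ : LieIdeal F L) (U V : LieSubalgebra F L) : LieSubalgebra F L where
  carrier := {x | ∃ u ∈ U, ∃ v ∈ V, x - u ∈ N₁ ∧ u - v ∈ N₂ ∧ v - x ∈ N₃}
  add_mem' := by
    rintro a b ⟨u, hu, v, hv, h1, h2, h3⟩ ⟨u', hu', v', hv', h1', h2', h3'⟩
    refine ⟨u + u', add_mem hu hu', v + v', add_mem hv hv', ?_, ?_, ?_⟩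
    · rw [add_sub_add_comm]; exact add_mem h1 h1'
    · rw [add_sub_add_comm]; exact add_mem h2 h2'
    · rw [add_sub_add_comm]; exact add_mem h3 h3'
  zero_mem' := ⟨0, zero_mem U, 0, zero_mem V, by simp, by simp, by simp⟩
  smul_mem' := by
    rintro c a ⟨u, hu, v, hv, h1, h2, h3⟩
    refine ⟨c • u, U.smul_mem c hu, c • v, V.smul_mem c hv, ?_, ?_, ?_⟩
    · rw [← smul_sub]; exact N₁.smul_mem c h1
    · rw [← smul_sub]; exact N₂.smul_mem c h2
    · rw [← smul_sub]; exact N₃.smul_mem c h3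
  lie_mem' := by
    rintro a b ⟨u, hu, v, hv, h1, h2, h3⟩ ⟨u', hu', v', hv', h1', h2', h3'⟩
    exact ⟨⁅u, u'⁆, U.lie_mem hu hu', ⁅v, v'⁆, V.lie_mem hv hv', lie_sub_lie_mem h1 h1',
      lie_sub_lie_mem h2 h2', lie_sub_lie_mem h3 h3'⟩

/-- A link is the set of `x` with `φ(x + N₁) = x + N₂`, where `φ` is an isomorphism inducing the
identity on `L/T`. `linkComp` is the set belonging to the composite isomorphism. -/
theorem Link.trans {N₁ N₂ N₃ T : LieIdeal F L} (h₁ : N₁ ⋖ T) (h₂ : N₂ ⋖ T) (h₃ : N₃ ⋖ T)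
    (h : Link N₁ N₂) (h' : Link N₂ N₃) : Link N₁ N₃ := by
  -- The main argument needs `N₁ + N₃ = T`, which fails when the two ideals coincide.
  by_cases h13 : N₁ = N₃
  · exact h13 ▸ Link.refl _
  have hT : N₁ ⊔ N₃ = T := h₁.wcovBy.sup_eq h₃.wcovBy h13
  obtain ⟨U, hU1, hU2, hU3, hU4⟩ := h
  obtain ⟨V, hV1, hV2, hV3, hV4⟩ := h'
  have key : ∀ x u v : L, x - u ∈ N₁ → u - v ∈ N₂ →
      ∃ n₁ ∈ N₁, ∃ n₃ ∈ N₃, n₁ + n₃ = v - x := by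
    intro x u v h1 h2
    rw [← LieSubmodule.mem_sup, hT]
    have := add_mem (h₁.le h1) (h₂.le h2)
    rw [sub_add_sub_cancel] at this
    rw [← neg_sub]
    exact neg_mem this
  -- With `u ∈ U` congruent to `x` modulo `N₁` and `v ∈ V` congruent to `u` modulo `N₂`, the
  -- difference `v - x` lies in `T = N₁ + N₃`. Adding its `N₁`-part to `x` leaves a difference in
  -- `N₃`.
  have cover : ∀ x : L, ∃ n₁ ∈ N₁, x + n₁ ∈ linkComp N₁ N₂ N₃ U V := by
    intro x
    obtain ⟨a, ha, u, hu, rfl⟩ := exists_add_eq hU1 x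
    obtain ⟨b, hb, v, hv, rfl⟩ := exists_add_eq hV1 u
    obtain ⟨n₁, hn₁, n₃, hn₃, hn⟩ := key (a + (b + v)) (b + v) v (by simpa using ha)
      (by simpa using hb)
    refine ⟨n₁, hn₁, b + v, hu, v, hv, ?_, by simpa using hb, ?_⟩
    · have : a + (b + v) + n₁ - (b + v) = a + n₁ := by abel
      rw [this]; exact add_mem ha hn₁
    · have : v - (a + (b + v) + n₁) = n₃ := by
        rw [← sub_sub, ← hn]; abel
      rw [this]; exact hn₃
  have cover' : ∀ x : L, ∃ n₃ ∈ N₃, x + n₃ ∈ linkComp N₁ N₂ N₃ U V := by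
    intro x
    obtain ⟨b, hb, v, hv, rfl⟩ := exists_add_eq hV2 x
    obtain ⟨a, ha, u, hu, huv⟩ := exists_add_eq hU2 v
    have h2 : u - v ∈ N₂ := by
      rw [← huv, sub_add_cancel_right]; exact neg_mem ha
    have h5 : b + v - v ∈ N₃ := by simpa using hb
    have h6 : (b + v) - u ∈ N₁ ⊔ N₃ := by
      rw [hT]
      have := sub_mem (h₃.le h5) (h₂.le h2)
      have e : b + v - v - (u - v) = b + v - u := by abel
      rwa [e] at this
    obtain ⟨n₁, hn₁, n₃, hn₃, hn⟩ := LieSubmodule.mem_sup _ _ _ |>.1 h6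
    refine ⟨-n₃, neg_mem hn₃, u, hu, v, hv, ?_, h2, ?_⟩
    · have : b + v + -n₃ - u = n₁ := by
        have : b + v = n₁ + n₃ + u := by rw [hn]; abel
        rw [this]; abel
      rw [this]; exact hn₁
    · have : v - (b + v + -n₃) = n₃ - b := by abel
      rw [this]; exact sub_mem hn₃ hb
  refine ⟨linkComp N₁ N₂ N₃ U V, sup_eq_top_of_forall fun l => ?_,
    sup_eq_top_of_forall fun l => ?_, ?_, ?_⟩
  · obtain ⟨n, hn, h⟩ := cover l
    exact ⟨-n, neg_mem hn, l + n, h, by abel⟩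
  · obtain ⟨n, hn, h⟩ := cover' l
    exact ⟨-n, neg_mem hn, l + n, h, by abel⟩
  · rintro x ⟨u, hu, v, hv, h1, h2, h3⟩
    constructor
    · intro hx
      have hu1 : u ∈ N₁ := by
        have := sub_mem hx h1
        rwa [sub_sub_cancel] at this
      have hv2 : v ∈ N₂ := by
        have := sub_mem ((hU3 u hu).1 hu1) h2
        rwa [sub_sub_cancel] at this
      have := sub_mem ((hV3 v hv).1 hv2) h3
      rwa [sub_sub_cancel] at this
    · intro hx
      have hv3 : v ∈ N₃ := by
        have := add_mem h3 hx
        rwa [sub_add_cancel] at this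
      have hu2 : u ∈ N₂ := by
        have := add_mem h2 ((hV3 v hv).2 hv3)
        rwa [sub_add_cancel] at this
      have := add_mem h1 ((hU3 u hu).2 hu2)
      rwa [sub_add_cancel] at this
  · intro x hx1 hx3
    exact ⟨0, zero_mem U, 0, zero_mem V, by simpa using hx1, by simp, by simpa using hx3⟩

/-- Both ideals have the same sum `L` and the same intersection with `U`. -/
theorem Link.finrank_eq [FiniteDimensional F L] {N₁ N₂ : LieIdeal F L} (h : Link N₁ N₂) :
    Module.finrank F N₁ = Module.finrank F N₂ := by
  obtain ⟨U, h1, h2, h3, -⟩ := h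
  have e1 := Submodule.finrank_sup_add_finrank_inf_eq N₁.toSubmodule U.toSubmodule
  have e2 := Submodule.finrank_sup_add_finrank_inf_eq N₂.toSubmodule U.toSubmodule
  have e3 : N₁.toSubmodule ⊓ U.toSubmodule = N₂.toSubmodule ⊓ U.toSubmodule := by
    ext x
    exact ⟨fun ⟨ha, hb⟩ => ⟨(h3 x hb).1 ha, hb⟩, fun ⟨ha, hb⟩ => ⟨(h3 x hb).2 ha, hb⟩⟩
  rw [h1] at e1
  rw [h2, ← e3] at e2
  have e4 := e1.symm.trans e2
  exact Nat.add_right_cancel e4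

/-! ### Nonabelian chief factors and primitive quotients of type 3. -/

/-- `T/N` is a nonabelian minimal ideal of `L/N` with trivial centraliser. -/
def IsCrownPair (T N : LieIdeal F L) : Prop := N ⋖ T ∧ centraliser T N = N

/-- A second minimal ideal of `L/N` would centralise the first. -/
theorem IsCrownPair.eq {T T' N : LieIdeal F L} (h : IsCrownPair T N) (h' : IsCrownPair T' N) :
    T = T' := by
  by_contra hne
  have h1 : T ⊓ T' = N := inf_eq_of_covBy h.1 h'.1.le fun hle =>
    hne ((h'.1.eq_or_eq h.1.le hle).resolve_left h.1.ne')
  have h2 : T' ≤ N := h.2 ▸ le_centraliser_of_inf_le h1.le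
  exact h'.1.lt.not_ge h2

theorem inf_centraliser_eq {X Y : LieIdeal F L} (h : Y ⋖ X) (hna : ¬ X ≤ centraliser X Y) :
    X ⊓ centraliser X Y = Y :=
  inf_eq_of_covBy h (le_centraliser_self X Y) hna

theorem covBy_sup_of_inf_eq {X Y N : LieIdeal F L} (h : Y ⋖ X) (h' : X ⊓ N = Y) :
    N ⋖ X ⊔ N :=
  covBy_sup_of_inf_covBy_left (h'.symm ▸ h)

theorem isCrownPair_of_not_le {X Y : LieIdeal F L} (h : Y ⋖ X) (hna : ¬ X ≤ centraliser X Y) :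
    IsCrownPair (crownTop X Y) (centraliser X Y) :=
  ⟨covBy_sup_of_inf_eq h (inf_centraliser_eq h hna),
    (LIso.of_inf_sup (inf_centraliser_eq h hna) rfl).centraliser_eq.symm⟩

theorem lIso_crownTop {X Y : LieIdeal F L} (h : Y ⋖ X) (hna : ¬ X ≤ centraliser X Y) :
    LIso (factor X Y) (factor (crownTop X Y) (centraliser X Y)) :=
  LIso.of_inf_sup (inf_centraliser_eq h hna) rfl

/-- The core of a maximal supplement of a nonabelian chief factor `X/Y` is either `C_L(X/Y)`, or
`L` modulo that core has `C_L(X/Y)` as a second minimal ideal. -/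
theorem core_of_not_le_centraliser {M : LieSubalgebra F L} (hM : IsCoatom M) {X Y : LieIdeal F L}
    (h : Y ⋖ X) (hs : IsSupplement M X Y) (hna : ¬ X ≤ centraliser X Y) :
    core M = centraliser X Y ∨
      (core M ⋖ centraliser X Y ∧ centraliser X Y ⊓ (X ⊔ core M) = core M ∧
        centraliser X Y ⊔ (X ⊔ core M) = crownTop X Y ∧
        IsCrownPair (crownTop X Y) (X ⊔ core M) ∧
        centraliser (centraliser X Y) (core M) = X ⊔ core M ∧
        Link (centraliser X Y) (X ⊔ core M)) := by
  set N := centraliser X Y with hN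
  set K := core M with hK
  have hXK : X ⊓ K = Y := inf_eq_of_covBy h hs.le_core hs.not_le_core
  have hKN : K ≤ N := le_centraliser_of_inf_le hXK.le
  by_cases hNK : N ≤ K
  · exact Or.inl (le_antisymm hKN hNK)
  right
  have hNM : N.toSubmodule ⊔ M.toSubmodule = ⊤ := sup_eq_top_of_isCoatom hM hNK
  have hMN : ∀ w ∈ M, w ∈ N → w ∈ K := fun w hw hwN =>
    inf_le_core (D := N) hs.2.1 (fun x hx w _ hwN => by
      rw [← lie_skew]
      exact neg_mem (hs.2.2 (hwN x hx)).2) hw hwN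
  have hcov : K ⋖ N := by
    -- An ideal `J` strictly above `K` is supplemented by `M`. If also `J ≤ N`, the modular law
    -- gives `N = J + (M ∩ N)`, and `M ∩ N ⊆ K ⊆ J`.
    refine ⟨lt_of_le_of_ne hKN fun he => hNK he.ge, fun J hKJ hJN => hJN.not_ge fun n hn => ?_⟩
    have hJM := sup_eq_top_of_isCoatom hM (J := J) hKJ.not_ge
    obtain ⟨j, hj, m, hm, rfl⟩ := exists_add_eq hJM n
    have h1 : m ∈ N := by
      have := sub_mem hn (hJN.le hj)
      rwa [add_sub_cancel_left] at this
    exact add_mem hj (hKJ.le (hMN m hm h1))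
  have hinf : N ⊓ (X ⊔ K) = K := by
    rw [inf_comm, sup_comm, sup_inf_assoc_of_le X hKN, inf_centraliser_eq h hna]
    exact sup_eq_left.2 (hXK ▸ inf_le_right)
  have hsup : N ⊔ (X ⊔ K) = crownTop X Y := by
    rw [crownTop, ← hN, sup_left_comm, sup_eq_left.2 hKN]
  have hXle : X ⊔ K ≤ centraliser N K := le_centraliser_of_inf_le hinf.le
  have hcN : centraliser N K = X ⊔ K := by
    refine le_antisymm (fun c hc => ?_) hXle
    obtain ⟨x, hx, m, hm, rfl⟩ := exists_add_eq hs.2.1 c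
    have hmc : m ∈ centraliser N K := by
      have := sub_mem hc (hXle (LieSubmodule.mem_sup_left hx))
      rwa [add_sub_cancel_left] at this
    refine add_mem (LieSubmodule.mem_sup_left hx) (LieSubmodule.mem_sup_right ?_)
    refine inf_le_core (D := centraliser N K) hNM (fun n hn w _ hwC => ?_) hm hmc
    rw [← lie_skew]
    exact neg_mem (mem_of_mem_core (hwC n hn))
  refine ⟨hcov, hinf, hsup, ⟨?_, ?_⟩, hcN, M, hNM, ?_, ?_, ?_⟩
  · rw [← hsup]
    exact covBy_sup_of_inf_eq hcov hinf
  · rw [← (LIso.of_inf_sup hinf hsup).centraliser_eq, hcN]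
  · refine sup_eq_top_of_isCoatom hM fun h' => hs.not_le_core (le_sup_left.trans h')
  · intro x hx
    constructor
    · exact fun hxN => LieSubmodule.mem_sup_right (hMN x hx hxN)
    · intro hxX
      refine hKN (inf_le_core (D := X ⊔ K) hNM (fun n hn w _ hw => ?_) hx hxX)
      rw [← lie_skew]
      exact neg_mem (mem_of_mem_core (hXle hw n hn))
  · intro x hx hx'
    exact mem_of_mem_core (hinf.le ⟨hx, hx'⟩)

theorem comap_subalgebra_le_iff {K : LieIdeal F L} {U V : LieSubalgebra F (L ⧸ K)} :
    U.comap (proj K) ≤ V.comap (proj K) ↔ U ≤ V := by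
  refine ⟨fun h p hp => ?_, fun h x hx => h hx⟩
  obtain ⟨x, rfl⟩ := proj_surjective K p
  exact h hp

theorem exists_comap_eq {K : LieIdeal F L} {M : LieSubalgebra F L} (h : ∀ x ∈ K, x ∈ M) :
    ∃ U : LieSubalgebra F (L ⧸ K), U.comap (proj K) = M := by
  refine ⟨M.map (proj K), ?_⟩
  ext x
  rw [LieSubalgebra.mem_comap, LieSubalgebra.mem_map]
  constructor
  · rintro ⟨m, hm, hx⟩
    have := sub_mem hm (h _ (proj_eq_proj.1 hx))
    rwa [sub_sub_cancel] at this
  · exact fun hx => ⟨x, hx, rfl⟩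

theorem comap_subalgebra_eq_top {K : LieIdeal F L} {U : LieSubalgebra F (L ⧸ K)} :
    U.comap (proj K) = ⊤ ↔ U = ⊤ := by
  rw [eq_top_iff, eq_top_iff, ← comap_subalgebra_le_iff (K := K)]
  rfl

theorem isCoatom_comap_iff {K : LieIdeal F L} {U : LieSubalgebra F (L ⧸ K)} :
    IsCoatom (U.comap (proj K)) ↔ IsCoatom U := by
  constructor
  · intro h
    refine ⟨fun h' => h.1 (comap_subalgebra_eq_top.2 h'), fun V hV => ?_⟩
    rw [← comap_subalgebra_eq_top]
    refine h.2 _ ?_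
    rwa [lt_iff_le_not_ge, comap_subalgebra_le_iff, comap_subalgebra_le_iff,
      ← lt_iff_le_not_ge]
  · intro h
    refine ⟨fun h' => h.1 (comap_subalgebra_eq_top.1 h'), fun V hV => ?_⟩
    obtain ⟨V, rfl⟩ := exists_comap_eq (K := K) (M := V) fun x hx => hV.le (by
      rw [LieSubalgebra.mem_comap, proj_eq_zero.2 hx]
      exact zero_mem U)
    rw [comap_subalgebra_eq_top]
    refine h.2 _ ?_
    rwa [lt_iff_le_not_ge, comap_subalgebra_le_iff, comap_subalgebra_le_iff,
      ← lt_iff_le_not_ge] at hV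

theorem core_comap {K : LieIdeal F L} (U : LieSubalgebra F (L ⧸ K)) :
    core (U.comap (proj K)) = LieIdeal.comap (proj K) (core U) := by
  apply le_antisymm
  · intro x hx
    rw [LieIdeal.mem_comap]
    have h1 : factor (core (U.comap (proj K))) K ≤ core U := le_core fun p hp => by
      obtain ⟨a, ha, rfl⟩ := mem_factor.1 hp
      exact show a ∈ U.comap (proj K) from mem_of_mem_core ha
    exact h1 (mem_factor.2 ⟨x, hx, rfl⟩)
  · exact le_core fun x hx => show proj K x ∈ U from mem_of_mem_core hx

/-- The structure of two minimal ideals of a primitive quotient of type 3. -/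
theorem IsPrimitiveType3.link {K : LieIdeal F L} (h : IsPrimitiveType3 F (L ⧸ K))
    {P Q : LieIdeal F (L ⧸ K)} (hP : IsAtom P) (hQ : IsAtom Q) (hPQ : P ≠ Q) :
    ∃ N₁ N₂ T : LieIdeal F L, IsCrownPair T N₁ ∧ IsCrownPair T N₂ ∧ Link N₁ N₂ ∧
      LIso P (factor T N₁) ∧ LIso Q (factor T N₂) := by
  obtain ⟨⟨U, hU, hUc⟩, -, hna⟩ := h
  have hM := isCoatom_comap_iff.2 hU
  have hK : core (U.comap (proj K)) = K := by rw [core_comap, hUc, comap_proj_bot]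
  have hPna := hna P hP
  set X := LieIdeal.comap (proj K) P with hX
  set Z := LieIdeal.comap (proj K) Q with hZ
  have hPX : factor X K = P := factor_comap P
  have hQZ : factor Z K = Q := factor_comap Q
  have hcX : K ⋖ X := isAtom_iff_covBy.1 hP
  have hcZ : K ⋖ Z := isAtom_iff_covBy.1 hQ
  rw [← hPX, isLieAbelian_factor_iff] at hPna
  have hs : IsSupplement (U.comap (proj K)) X K :=
    isSupplement_of_isCoatom hM hcX.le hK.ge (by rw [hK]; exact hcX.lt.not_ge)
  have hXZ : X ⊓ Z = K := inf_eq_of_covBy hcX hcZ.le fun hle => hPQ (by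
    rw [← hPX, ← hQZ, (hcZ.eq_or_eq hcX.le hle).resolve_left hcX.ne'])
  have hZN : Z ≤ centraliser X K := le_centraliser_of_inf_le hXZ.le
  have hcr := isCrownPair_of_not_le hcX hPna
  have hiso := lIso_crownTop hcX hPna
  rcases core_of_not_le_centraliser hM hcX hs hPna with h1 | ⟨h1, -, h3, h4, -, h6⟩
  -- If the core were the centraliser, the second minimal ideal, which centralises the first, would
  -- vanish in `L/K`.
  · rw [hK] at h1
    rw [← h1] at hZN
    exact absurd hZN hcZ.lt.not_ge
  · rw [hK] at h1 h3 h4 h6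
    rw [sup_eq_left.2 hcX.le] at h3 h4 h6
    have hNZ : centraliser X K = Z := ((h1.eq_or_eq hcZ.le hZN).resolve_left hcZ.ne').symm
    refine ⟨_, _, _, hcr, h4, h6, hPX ▸ hiso, ?_⟩
    rw [← hQZ]
    exact LIso.of_inf_sup (by rw [inf_comm]; exact hXZ) (hNZ ▸ h3)

/-- Modulo `N₁ ∩ N₂` the linking subalgebra is maximal and core-free, like the diagonal in a product
of two copies of a minimal ideal. -/
theorem isPrimitiveType3_of_link {T N₁ N₂ : LieIdeal F L} (h₁ : IsCrownPair T N₁)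
    (h₂ : IsCrownPair T N₂) (hne : N₁ ≠ N₂) (hl : Link N₁ N₂) :
    IsPrimitiveType3 F (L ⧸ (N₁ ⊓ N₂)) ∧
      IsAtom (factor N₁ (N₁ ⊓ N₂)) ∧ IsAtom (factor N₂ (N₁ ⊓ N₂)) ∧
      factor N₁ (N₁ ⊓ N₂) ≠ factor N₂ (N₁ ⊓ N₂) := by
  set K := N₁ ⊓ N₂ with hK
  have hT : N₁ ⊔ N₂ = T := h₁.1.wcovBy.sup_eq h₂.1.wcovBy hne
  have hc1 : K ⋖ N₁ := inf_covBy_of_covBy_sup_right (hT.symm ▸ h₂.1)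
  have hc2 : K ⋖ N₂ := inf_covBy_of_covBy_sup_left (hT.symm ▸ h₁.1)
  have hfne : factor N₁ K ≠ factor N₂ K := fun he => hne (by
    rw [← comap_factor hc1.le, he, comap_factor hc2.le])
  have ha1 : IsAtom (factor N₁ K) := (isChiefFactor_iff.2 hc1).2
  have ha2 : IsAtom (factor N₂ K) := (isChiefFactor_iff.2 hc2).2
  obtain ⟨U, hU1, hU2, hU3, hU4⟩ := hl
  have hKU : ∀ x ∈ K, x ∈ U := fun x hx => hU4 x hx.1 hx.2
  -- Such a `J` centralises `(N₁ + N₂)/N₂ = T/N₂`, whose centraliser is `N₂`.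
  have hCK : ∀ J : LieIdeal F L, J ⊓ N₁ ≤ K → J ≤ N₂ := by
    intro J hJ j hj
    rw [← h₂.2]
    intro t ht
    rw [← hT, LieSubmodule.mem_sup] at ht
    obtain ⟨a, ha, b, hb, rfl⟩ := ht
    rw [lie_add]
    exact add_mem (hJ ⟨lie_mem_left F L J _ _ hj, N₁.lie_mem ha⟩).2 (N₂.lie_mem hb)
  have hCK' : ∀ J : LieIdeal F L, J ⊓ N₂ ≤ K → J ≤ N₁ := by
    intro J hJ j hj
    rw [← h₁.2]
    intro t ht
    rw [← hT, LieSubmodule.mem_sup] at ht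
    obtain ⟨a, ha, b, hb, rfl⟩ := ht
    rw [lie_add]
    exact add_mem (N₁.lie_mem ha) (hJ ⟨lie_mem_left F L J _ _ hj, N₂.lie_mem hb⟩).1
  have hcore : core U = K := by
    refine le_antisymm ?_ (le_core hKU)
    exact le_inf (hCK' _ fun x hx => ⟨(hU3 x (mem_of_mem_core hx.1)).2 hx.2, hx.2⟩)
      (hCK _ fun x hx => ⟨hx.2, (hU3 x (mem_of_mem_core hx.1)).1 hx.2⟩)
  have hUM : IsCoatom U := by
    refine ⟨?_, fun V hUV => ?_⟩
    · rintro rfl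
      exact hne (by ext x; exact hU3 x (LieSubalgebra.mem_top x))
    · have hV2 : N₂.toSubmodule ⊔ V.toSubmodule = ⊤ :=
        eq_top_iff.2 (hU2 ▸ sup_le_sup le_rfl hUV.le)
      -- `V ∩ N₁` is an ideal because `L = N₂ + V` and `[N₁, N₂] ⊆ K ⊆ V`. As `N₁/K` is minimal, it
      -- is `K`, forcing `V ≤ U`, or `N₁`, forcing `V = ⊤`.
      have hVN : ∀ w ∈ V, w ∈ N₁ → w ∈ core V := fun w hw hw1 =>
        inf_le_core (D := N₁) hV2 (fun x hx w _ hw1 =>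
          hUV.le (hKU _ ⟨N₁.lie_mem hw1, lie_mem_left F L N₂ _ _ hx⟩)) hw hw1
      rcases hc1.eq_or_eq (c := N₁ ⊓ core V)
        (le_inf hc1.le (le_core fun x hx => hUV.le (hKU x hx))) inf_le_left with h | h
      · refine absurd (fun v hv => ?_) hUV.not_ge
        obtain ⟨n, hn, u, hu, rfl⟩ := exists_add_eq hU1 v
        have hnV : n ∈ V := by
          have := sub_mem hv (hUV.le hu)
          rwa [add_sub_cancel_right] at this
        exact add_mem (hKU n (h.le ⟨hn, hVN n hnV hn⟩)) hu
      · refine eq_top_of_sup_of_le (eq_top_iff.2 (hU1 ▸ sup_le_sup le_rfl hUV.le))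
          fun x hx => mem_of_mem_core (h.ge hx).2
  have hatoms : {P : LieIdeal F (L ⧸ K) | IsAtom P} = {factor N₁ K, factor N₂ K} := by
    ext P
    constructor
    · intro hP
      have hJ : K ⋖ LieIdeal.comap (proj K) P := isAtom_iff_covBy.1 hP
      by_cases hle : LieIdeal.comap (proj K) P ≤ N₁
      · left
        rw [← (hc1.eq_or_eq hJ.le hle).resolve_left hJ.ne', factor_comap]
      · right
        have := hCK _ (inf_eq_of_covBy hJ hc1.le hle).le
        rw [Set.mem_singleton_iff, ← (hc2.eq_or_eq hJ.le this).resolve_left hJ.ne',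
          factor_comap]
    · rintro (rfl | rfl)
      exacts [ha1, ha2]
  refine ⟨⟨?_, ?_, ?_⟩, ha1, ha2, hfne⟩
  · obtain ⟨V, rfl⟩ := exists_comap_eq hKU
    refine ⟨V, isCoatom_comap_iff.1 hUM, ?_⟩
    rw [core_comap] at hcore
    rw [← factor_comap (core V), hcore]
    refine le_bot_iff.1 fun p hp => ?_
    obtain ⟨a, ha, rfl⟩ := mem_factor.1 hp
    exact proj_eq_zero.2 ha
  · rw [hatoms, Set.ncard_pair hfne]
  · intro P hP hab
    have hP' : P ∈ ({factor N₁ K, factor N₂ K} : Set _) := hatoms ▸ hP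
    rcases hP' with rfl | rfl
    · rw [isLieAbelian_factor_iff] at hab
      -- The factors `N₁/K` and `T/N₂` are `L`-isomorphic, so both have centraliser `N₂`.
      have : N₁ ≤ N₂ := by
        rw [← h₂.2]
        refine hab.trans ?_
        rw [(LIso.of_inf_sup (X := N₁) (N := N₂) rfl hT).centraliser_eq]
      exact hne ((h₁.1.eq_or_eq this h₂.1.le).resolve_right h₂.1.ne).symm
    · rw [isLieAbelian_factor_iff] at hab
      have : N₂ ≤ N₁ := by
        rw [← h₁.2]
        refine hab.trans ?_
        rw [(LIso.of_inf_sup (X := N₂) (N := N₁) (inf_comm _ _)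
          (by rw [sup_comm, hT])).centraliser_eq]
      exact hne ((h₂.1.eq_or_eq this h₁.1.le).resolve_right h₁.1.ne)

/-! ### Connectedness and its invariants. -/

/-- Connectedness of nonabelian chief factors in terms of their centralisers. -/
theorem lConnected_iff_link {A B X Y : LieIdeal F L} (hX : Y ⋖ X) (hA : B ⋖ A)
    (hXna : ¬ X ≤ centraliser X Y) (hAna : ¬ A ≤ centraliser A B) :
    LConnected X Y A B ↔
      crownTop X Y = crownTop A B ∧ Link (centraliser X Y) (centraliser A B) := by
  have cX := isCrownPair_of_not_le hX hXna
  have cA := isCrownPair_of_not_le hA hAna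
  have iX := lIso_crownTop hX hXna
  have iA := lIso_crownTop hA hAna
  constructor
  · rintro (h | ⟨K, hK, P, Q, hP, hQ, hPQ, hXP, hAQ⟩)
    · have h1 := h.centraliser_eq
      rw [h1] at cX ⊢
      exact ⟨cX.eq cA, Link.refl _⟩
    · obtain ⟨N₁, N₂, T, h1, h2, hl, hPN, hQN⟩ := hK.link hP hQ hPQ
      have e1 : centraliser X Y = N₁ := by rw [(hXP.trans hPN).centraliser_eq, h1.2]
      have e2 : centraliser A B = N₂ := by rw [(hAQ.trans hQN).centraliser_eq, h2.2]
      rw [e1] at cX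
      rw [e2] at cA
      exact ⟨(cX.eq h1).trans (h2.eq cA), e1.symm ▸ e2.symm ▸ hl⟩
  · rintro ⟨hT, hl⟩
    rw [← hT] at cA iA
    by_cases hne : centraliser X Y = centraliser A B
    · left
      rw [← hne] at iA
      exact iX.trans iA.symm
    · right
      obtain ⟨h3, ha1, ha2, hne'⟩ := isPrimitiveType3_of_link cX cA hne hl
      have hsup := cX.1.wcovBy.sup_eq cA.1.wcovBy hne
      refine ⟨_, h3, _, _, ha2, ha1, hne'.symm, iX.trans ?_, iA.trans ?_⟩
      · exact (LIso.of_inf_sup (inf_comm _ _) (by rw [sup_comm, hsup])).symm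
      · exact (LIso.of_inf_sup rfl hsup).symm

theorem LConnected.le_centraliser_iff {A B X Y : LieIdeal F L} (h : LConnected X Y A B) :
    X ≤ centraliser X Y ↔ A ≤ centraliser A B := by
  rw [← isLieAbelian_factor_iff, ← isLieAbelian_factor_iff]
  rcases h with h | ⟨K, hK, P, Q, hP, hQ, -, hXP, hAQ⟩
  · exact h.isLieAbelian_iff
  · rw [hXP.isLieAbelian_iff, hAQ.isLieAbelian_iff]
    exact iff_of_false (hK.2.2 P hP) (hK.2.2 Q hQ)

/-- The alternative through a primitive quotient of type 3 involves only nonabelian ideals. -/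
theorem LConnected.lIso {A B X Y : LieIdeal F L} (h : LConnected X Y A B)
    (hA : A ≤ centraliser A B) : LIso (factor X Y) (factor A B) := by
  rcases h with h | ⟨K, hK, P, Q, hP, hQ, -, hXP, hAQ⟩
  · exact h
  · rw [← isLieAbelian_factor_iff, hAQ.isLieAbelian_iff] at hA
    exact absurd hA (hK.2.2 Q hQ)

theorem LConnected.crownTop_eq {A B X Y : LieIdeal F L} (hX : Y ⋖ X) (hA : B ⋖ A)
    (h : LConnected X Y A B) : crownTop X Y = crownTop A B := by
  by_cases hab : A ≤ centraliser A B
  · have hab' := h.le_centraliser_iff.2 hab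
    rw [crownTop, crownTop, sup_eq_right.2 hab, sup_eq_right.2 hab',
      (h.lIso hab).centraliser_eq]
  · exact ((lConnected_iff_link hX hA (mt h.le_centraliser_iff.1 hab) hab).1 h).1

theorem LConnected.trans {A B X Y D E : LieIdeal F L} (hX : Y ⋖ X) (hA : B ⋖ A) (hD : E ⋖ D)
    (h : LConnected X Y A B) (h' : LConnected A B D E) : LConnected X Y D E := by
  by_cases hab : A ≤ centraliser A B
  · exact Or.inl ((h.lIso hab).trans (h'.lIso (h'.le_centraliser_iff.1 hab)))
  · have hX' := mt h.le_centraliser_iff.1 hab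
    have hD' := mt h'.le_centraliser_iff.2 hab
    obtain ⟨h1, h2⟩ := (lConnected_iff_link hX hA hX' hab).1 h
    obtain ⟨h3, h4⟩ := (lConnected_iff_link hA hD hab hD').1 h'
    have cX := (isCrownPair_of_not_le hX hX').1
    have cA := (isCrownPair_of_not_le hA hab).1
    have cD := (isCrownPair_of_not_le hD hD').1
    rw [h1] at cX
    rw [← h3] at cD
    exact (lConnected_iff_link hX hD hX' hD').2 ⟨h1.trans h3, Link.trans cX cA cD h2 h4⟩

theorem LConnected.finrank_eq [FiniteDimensional F L] {A B X Y : LieIdeal F L} (hX : Y ⋖ X)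
    (hA : B ⋖ A) (h : LConnected X Y A B) :
    Module.finrank F (factor X Y) = Module.finrank F (factor A B) := by
  by_cases hab : A ≤ centraliser A B
  · exact (h.lIso hab).finrank_eq
  · have hX' := mt h.le_centraliser_iff.1 hab
    obtain ⟨h1, h2⟩ := (lConnected_iff_link hX hA hX' hab).1 h
    rw [(lIso_crownTop hX hX').finrank_eq, (lIso_crownTop hA hab).finrank_eq, h1]
    have e1 := finrank_factor_add (A := crownTop X Y) (B := centraliser X Y) le_sup_right
    have e2 := finrank_factor_add (A := crownTop A B) (B := centraliser A B) le_sup_right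
    rw [h1, h2.finrank_eq] at e1
    exact Nat.add_right_cancel (e1.trans e2.symm)

/-- The core of a maximal supplement of `X/Y` is an intersection of ideals `N` covered by the top
of the crown, with quotient connected to `X/Y`. -/
theorem exists_covBy_crownTop {M : LieSubalgebra F L} (hM : IsCoatom M) {X Y : LieIdeal F L}
    (h : Y ⋖ X) (hs : IsSupplement M X Y) {x : L} (hx : x ∉ core M) :
    ∃ N : LieIdeal F L, core M ≤ N ∧ N ⋖ crownTop X Y ∧ LConnected (crownTop X Y) N X Y ∧
      x ∉ N := by
  by_cases hab : X ≤ centraliser X Y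
  · have hXK : X ⊓ core M = Y := inf_eq_of_covBy h hs.le_core hs.not_le_core
    have hT : X ⊔ core M = crownTop X Y := by
      rw [crownTop, sup_eq_right.2 hab, centraliser_eq_sup_core h hs hab]
    exact ⟨core M, le_rfl, hT ▸ covBy_sup_of_inf_eq h hXK,
      Or.inl (LIso.of_inf_sup hXK hT).symm, hx⟩
  · have hc := isCrownPair_of_not_le h hab
    have hi := lIso_crownTop h hab
    rcases core_of_not_le_centraliser hM h hs hab with h1 | ⟨h1, h2, -, h4, -, h6⟩
    · exact ⟨_, h1.le, hc.1, Or.inl hi.symm, h1 ▸ hx⟩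
    · by_cases hxN : x ∈ centraliser X Y
      · refine ⟨X ⊔ core M, le_sup_right, h4.1, ?_, fun hx' => hx (h2.le ⟨hxN, hx'⟩)⟩
        rw [lConnected_iff_link h4.1 h (by rw [h4.2]; exact h4.1.lt.not_ge) hab, h4.2]
        refine ⟨?_, h6.symm⟩
        rw [crownTop, h4.2, sup_eq_left.2 h4.1.le]
      · exact ⟨_, h1.le, hc.1, Or.inl hi.symm, hxN⟩

/-! ### Supplements of nonabelian chief factors. -/

/-- A nonabelian minimal ideal is not contained in every maximal subalgebra. -/
theorem exists_supplement_of_isAtom [FiniteDimensional F L] {I : LieIdeal F L} (hI : IsAtom I)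
    (hna : ¬ IsLieAbelian I) :
    ∃ M : LieSubalgebra F L, M ≠ ⊤ ∧ I.toSubmodule ⊔ M.toSubmodule = ⊤ := by
  by_contra! hcon
  -- Fitting decomposition of `ad x`: for large `n ≥ 1` the image of `(ad x)^n` lies in `I` and its
  -- kernel in the Engel subalgebra. A proper Engel subalgebra would thus supplement `I`.
  have hengel : ∀ x ∈ I, LieSubalgebra.engel F x = ⊤ := by
    intro x hx
    by_contra hne
    refine hcon _ hne ?_
    obtain ⟨n, hn, hn1⟩ := ((LinearMap.eventually_codisjoint_ker_pow_range_pow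
      (LieAlgebra.ad F L x)).and (Filter.eventually_ge_atTop 1)).exists
    rw [eq_top_iff, ← codisjoint_iff.1 hn, sup_comm]
    refine sup_le_sup ?_ ?_
    · rintro _ ⟨y, rfl⟩
      obtain ⟨k, rfl⟩ := Nat.exists_eq_add_of_le' hn1
      rw [pow_succ']
      exact lie_mem_left F L I _ _ hx
    · intro y hy
      exact (LieSubalgebra.mem_engel_iff F x y).2 ⟨n, hy⟩
  have hnil : LieRing.IsNilpotent I := by
    rw [LieAlgebra.isNilpotent_iff_forall (R := F)]
    intro x
    have h1 : IsNilpotent (LieAlgebra.ad F L (x : L)) := by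
      obtain ⟨n, hn⟩ := Filter.eventually_atTop.1
        (LinearMap.eventually_iSup_ker_pow_eq (LieAlgebra.ad F L (x : L)))
      refine ⟨n, LinearMap.ext fun y => ?_⟩
      have hy : y ∈ LieSubalgebra.engel F (x : L) := hengel x x.2 ▸ LieSubalgebra.mem_top y
      obtain ⟨k, hk⟩ := (LieSubalgebra.mem_engel_iff F (x : L) y).1 hy
      have : y ∈ ⨆ m, LinearMap.ker (LieAlgebra.ad F L (x : L) ^ m) :=
        Submodule.mem_iSup_of_mem k hk
      rw [hn n le_rfl] at this
      exact this
    obtain ⟨n, hn⟩ := h1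
    refine ⟨n, LinearMap.ext fun y => Subtype.ext ?_⟩
    have key : ∀ (k : ℕ) (z : I), (((LieAlgebra.ad F I x ^ k) z : I) : L) =
        (LieAlgebra.ad F L (x : L) ^ k) z := by
      intro k
      induction k with
      | zero => intro z; rfl
      | succ k ih =>
        intro z
        rw [pow_succ, pow_succ, Module.End.mul_apply, Module.End.mul_apply, ih]
        rfl
    rw [key, hn]
    rfl
  have hnt : Nontrivial I := by
    rw [LieSubmodule.nontrivial_iff_ne_bot]
    exact hI.1
  have hZ : Nontrivial (LieAlgebra.center F I) := LieAlgebra.non_trivial_center_of_isNilpotent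
  obtain ⟨⟨z, hz⟩, hz0⟩ := exists_ne (0 : LieAlgebra.center F I)
  -- By Engel's theorem `I` is nilpotent, so its centre is nonzero. The centre is `I ⊓ centraliser I
  -- ⊥`, an ideal of `L`, hence all of `I` by minimality.
  have hzI : (z : L) ∈ I ⊓ centraliser I ⊥ := by
    refine ⟨z.2, fun a ha => ?_⟩
    rw [LieSubmodule.mem_bot, ← lie_skew, neg_eq_zero]
    exact congrArg Subtype.val ((LieModule.mem_maxTrivSubmodule F I I z).1 hz ⟨a, ha⟩)
  have hle : I ≤ centraliser I ⊥ := by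
    rcases hI.le_iff.1 (inf_le_left : I ⊓ centraliser I ⊥ ≤ I) with h | h
    · rw [h, LieSubmodule.mem_bot] at hzI
      exact absurd (Subtype.ext (Subtype.ext hzI)) hz0
    · exact inf_eq_left.1 h
  exact hna ⟨fun a b => Subtype.ext (hle a.2 b b.2)⟩

theorem exists_isSupplement_of_not_le [FiniteDimensional F L] {X Y : LieIdeal F L} (h : Y ⋖ X)
    (hna : ¬ X ≤ centraliser X Y) : ∃ M : LieSubalgebra F L, IsSupplement M X Y := by
  rw [← isLieAbelian_factor_iff] at hna
  obtain ⟨M, hM, hsup⟩ := exists_supplement_of_isAtom (isChiefFactor_iff.2 h).2 hna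
  refine ⟨M.comap (proj Y), fun h' => hM (comap_subalgebra_eq_top.1 h'),
    sup_eq_top_of_forall fun l => ?_, le_inf h.le fun y hy => ?_⟩
  · obtain ⟨p, hp, m, hm, hl⟩ := exists_add_eq hsup (proj Y l)
    obtain ⟨a, ha, rfl⟩ := mem_factor.1 hp
    refine ⟨a, ha, l - a, ?_, add_sub_cancel a l⟩
    rw [LieSubalgebra.mem_comap, map_sub, ← hl, add_sub_cancel_left]
    exact hm
  · change proj Y y ∈ M
    rw [proj_eq_zero.2 hy]
    exact zero_mem M

/-! ### The crown and the ideals covered by its top. -/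

/-- The ideals `N` between `R` and `C` with `C/N` a chief factor connected to `A/B`. -/
def crownCoatoms (A B : LieIdeal F L) : Set (LieIdeal F L) :=
  {N | crownBot A B ≤ N ∧ N ⋖ crownTop A B ∧ LConnected (crownTop A B) N A B}

variable {A B : LieIdeal F L}

theorem centraliser_le_of_mem_crownCoatoms (hA : B ⋖ A) {N : LieIdeal F L}
    (hN : N ∈ crownCoatoms A B) : centraliser (crownTop A B) N ≤ crownTop A B := by
  have h := hN.2.2.crownTop_eq hN.2.1 hA
  have h2 : centraliser (crownTop A B) N ≤ crownTop (crownTop A B) N := le_sup_right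
  exact h2.trans h.le

theorem exists_mem_crownCoatoms_of_core (hA : B ⋖ A) {M : LieSubalgebra F L} (hM : IsCoatom M)
    {X Y : LieIdeal F L} (hX : Y ⋖ X) (hc : LConnected X Y A B) (hs : IsSupplement M X Y) {x : L}
    (hx : x ∉ core M) : ∃ N ∈ crownCoatoms A B, x ∉ N := by
  obtain ⟨N, h1, h2, h3, h4⟩ := exists_covBy_crownTop hM hX hs hx
  have hR : crownBot A B ≤ core M := sInf_le ⟨M, hM, ⟨X, Y, isChiefFactor_iff.2 hX, hc, hs⟩, rfl⟩
  have h5 := h3.trans h2 hX hA hc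
  rw [hc.crownTop_eq hX hA] at h2 h5
  exact ⟨N, ⟨hR.trans h1, h2, h5⟩, h4⟩

theorem exists_core_of_not_mem {x : L} (hx : x ∉ crownBot A B) :
    ∃ M : LieSubalgebra F L, IsCoatom M ∧ crownBot A B ≤ core M ∧ x ∉ core M ∧
      ∃ X Y : LieIdeal F L, Y ⋖ X ∧ LConnected X Y A B ∧ IsSupplement M X Y := by
  obtain ⟨J, hJ, hxJ⟩ : ∃ J ∈ crownFamily A B, x ∉ J := by
    by_contra! h
    refine hx ?_
    rw [← SetLike.mem_coe, crownBot, LieSubmodule.coe_sInf]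
    exact Set.mem_iInter₂.2 h
  have hR : crownBot A B ≤ J := sInf_le hJ
  obtain ⟨M, hM, ⟨X, Y, hX, hc, hs⟩, rfl⟩ := hJ
  exact ⟨M, hM, hR, hxJ, X, Y, isChiefFactor_iff.1 hX, hc, hs⟩

/-- `R` is an intersection of cores of maximal subalgebras, each of which contains `R` and so
survives in `L/R`. -/
theorem frattini_quotient_crownBot : frattini F (L ⧸ crownBot A B) = ⊥ := by
  refine le_bot_iff.1 fun p hp => ?_
  obtain ⟨x, rfl⟩ := proj_surjective _ p
  rw [LieSubmodule.mem_bot, proj_eq_zero]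
  by_contra hx
  obtain ⟨M, hM, hR, hxM, -⟩ := exists_core_of_not_mem hx
  obtain ⟨U, rfl⟩ := exists_comap_eq (K := crownBot A B) fun y hy => mem_of_mem_core (hR hy)
  rw [core_comap] at hxM
  have hle : frattini F (L ⧸ crownBot A B) ≤ core U := le_core fun y hy =>
    (sInf_le (isCoatom_comap_iff.1 hM) : sInf _ ≤ U) (mem_of_mem_core hy)
  exact hxM (hle hp)

theorem exists_mem_crownCoatoms (hA : B ⋖ A) {I : LieIdeal F L} (hI : ¬ I ≤ crownBot A B) :
    ∃ N ∈ crownCoatoms A B, ¬ I ≤ N := by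
  obtain ⟨x, hxI, hx⟩ := SetLike.not_le_iff_exists.1 hI
  obtain ⟨M, hM, -, hxM, X, Y, hX, hc, hs⟩ := exists_core_of_not_mem hx
  obtain ⟨N, hN, hxN⟩ := exists_mem_crownCoatoms_of_core hA hM hX hc hs hxM
  exact ⟨N, hN, fun h => hxN (h hxI)⟩

theorem crownBot_le_core [FiniteDimensional F L] {X Y : LieIdeal F L}
    (hX : IsSupplementedChiefFactor X Y) (hc : LConnected X Y A B) :
    ∃ M : LieSubalgebra F L, IsCoatom M ∧ IsSupplement M X Y ∧ crownBot A B ≤ core M := by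
  obtain ⟨hX, M, hM⟩ := hX
  obtain ⟨M, hMc, hM⟩ := hM.exists_isCoatom
  exact ⟨M, hMc, hM, sInf_le ⟨M, hMc, ⟨X, Y, hX, hc, hM⟩, rfl⟩⟩

theorem not_le_crownBot [FiniteDimensional F L] {X Y : LieIdeal F L}
    (hX : IsSupplementedChiefFactor X Y) (hc : LConnected X Y A B) : ¬ X ≤ crownBot A B := by
  obtain ⟨M, -, hM, hR⟩ := crownBot_le_core hX hc
  exact fun h => hM.not_le_core (h.trans hR)

theorem crownBot_le_crownTop [FiniteDimensional F L] (hAB : IsSupplementedChiefFactor A B) :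
    crownBot A B ≤ crownTop A B := by
  obtain ⟨N, hN, -⟩ := exists_mem_crownCoatoms (isChiefFactor_iff.1 hAB.1)
    (not_le_crownBot hAB (Or.inl (LIso.refl _)))
  exact hN.1.trans hN.2.1.le

/-- `I` centralises `C/N`, and the centraliser of `C/N` lies in its crown top, which is `C` by
connectedness. -/
theorem le_crownTop_of_inf_le (hA : B ⋖ A) {I N : LieIdeal F L} (hN : N ∈ crownCoatoms A B)
    (h : crownTop A B ⊓ I ≤ N) : I ≤ crownTop A B :=
  (le_centraliser_of_inf_le h).trans (centraliser_le_of_mem_crownCoatoms hA hN)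

theorem le_crownTop_of_covBy (hA : B ⋖ A) {I : LieIdeal F L} (hRT : crownBot A B ≤ crownTop A B)
    (hI : crownBot A B ⋖ I) : I ≤ crownTop A B := by
  by_contra hle
  obtain ⟨N, hN, -⟩ := exists_mem_crownCoatoms hA hI.lt.not_ge
  refine hle (le_crownTop_of_inf_le hA hN ?_)
  rw [inf_comm, inf_eq_of_covBy hI hRT hle]
  exact hN.1

theorem sup_eq_crownTop {I N : LieIdeal F L} (hN : N ∈ crownCoatoms A B)
    (hI : I ≤ crownTop A B) (h : ¬ I ≤ N) : I ⊔ N = crownTop A B :=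
  (hN.2.1.eq_or_eq le_sup_right (sup_le hI hN.2.1.le)).resolve_left fun h' =>
    h (sup_eq_right.1 h')

theorem lConnected_of_inf_sup (hA : B ⋖ A) {X Y N : LieIdeal F L} (hN : N ∈ crownCoatoms A B)
    (hX : Y ⋖ X) (h : X ⊓ N = Y) (h' : X ⊔ N = crownTop A B) : LConnected X Y A B :=
  LConnected.trans hX hN.2.1 hA (Or.inl (LIso.of_inf_sup h h')) hN.2.2

theorem isSupplementedChiefFactor_of_covBy (hA : B ⋖ A) {I : LieIdeal F L}
    (hRT : crownBot A B ≤ crownTop A B) (hI : crownBot A B ⋖ I) :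
    IsSupplementedChiefFactor I (crownBot A B) ∧ LConnected I (crownBot A B) A B := by
  constructor
  · obtain ⟨x, hxI, hx⟩ := SetLike.not_le_iff_exists.1 hI.lt.not_ge
    obtain ⟨M, hM, hR, hxM, -⟩ := exists_core_of_not_mem hx
    exact ⟨isChiefFactor_iff.2 hI, M,
      isSupplement_of_isCoatom hM hI.le hR fun h => hxM (h hxI)⟩
  · obtain ⟨N, hN, hIN⟩ := exists_mem_crownCoatoms hA hI.lt.not_ge
    exact lConnected_of_inf_sup hA hN hI (inf_eq_of_covBy hI hN.1 hIN)
      (sup_eq_crownTop hN (le_crownTop_of_covBy hA hRT hI) hIN)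

/-! ### Complements, supplements and the socle. -/

/-- The interval between `R` and `C` is complemented. -/
theorem exists_complement [FiniteDimensional F L] (hA : B ⋖ A) {X : LieIdeal F L}
    (hRX : crownBot A B ≤ X) (hXT : X ≤ crownTop A B) :
    ∃ Z : LieIdeal F L, crownBot A B ≤ Z ∧ X ⊔ Z = crownTop A B ∧ X ⊓ Z = crownBot A B := by
  have := LieSubmodule.wellFoundedLT_of_isArtinian F L L
  obtain ⟨Z, ⟨hRZ, hZ⟩, hmin⟩ := WellFounded.has_min
    (wellFounded_lt : WellFounded ((· < ·) : LieIdeal F L → LieIdeal F L → Prop))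
    {Z | crownBot A B ≤ Z ∧ X ⊔ Z = crownTop A B}
    ⟨crownTop A B, hRX.trans hXT, sup_eq_right.2 hXT⟩
  refine ⟨Z, hRZ, hZ, le_antisymm ?_ (le_inf hRX hRZ)⟩
  by_contra hle
  -- If `X ∩ Z` exceeds `R`, some `N` satisfies `(X ∩ Z) + N = C`. Then `Z ∩ N` is a smaller ideal
  -- that still spans `C` together with `X`.
  obtain ⟨N, hN, hXZN⟩ := exists_mem_crownCoatoms hA hle
  have hT := sup_eq_crownTop hN (inf_le_left.trans hXT) hXZN
  refine hmin (Z ⊓ N) ⟨le_inf hRZ hN.1, ?_⟩ (lt_of_le_of_ne inf_le_left fun h =>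
    hXZN (inf_le_right.trans (inf_eq_left.1 h)))
  have h1 : X ⊓ Z ⊔ Z ⊓ N = Z := by
    rw [inf_comm Z N, ← sup_inf_assoc_of_le N (inf_le_right : X ⊓ Z ≤ Z), hT]
    exact inf_eq_right.2 (hZ ▸ le_sup_right)
  calc X ⊔ Z ⊓ N = X ⊔ (X ⊓ Z ⊔ Z ⊓ N) := by rw [← sup_assoc, sup_inf_self]
    _ = crownTop A B := by rw [h1, hZ]

/-- Every chief factor `C/N` with `R ≤ N` is supplemented. -/
theorem exists_supplement_crownCoatom [FiniteDimensional F L] (hA : B ⋖ A)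
    {N : LieIdeal F L} (hN : N ∈ crownCoatoms A B) :
    ∃ V : LieSubalgebra F L, IsSupplement V (crownTop A B) N := by
  by_cases hab : crownTop A B ≤ centraliser (crownTop A B) N
  swap
  · exact exists_isSupplement_of_not_le hN.2.1 hab
  -- If one `C/N` is abelian, connectedness makes all of them abelian, so `[C, C]` lies in their
  -- intersection `R`.
  have hab' : ∀ a ∈ crownTop A B, ∀ b ∈ crownTop A B, ⁅a, b⁆ ∈ crownBot A B := by
    intro a ha b hb
    by_contra hx
    obtain ⟨M, hM, -, hxM, X, Y, hX, hc, hs⟩ := exists_core_of_not_mem hx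
    obtain ⟨N', hN', hxN⟩ := exists_mem_crownCoatoms_of_core hA hM hX hc hs hxM
    exact hxN (hN'.2.2.le_centraliser_iff.2 (hN.2.2.le_centraliser_iff.1 hab) ha b hb)
  -- A minimal `U` containing `R` with `C + U = L` meets `C` only in `R`. One `U` then serves every
  -- `N`, through `U + N`.
  obtain ⟨U, ⟨hRU, hU⟩, hmin⟩ := WellFounded.has_min
    (InvImage.wf (fun U : LieSubalgebra F L => U.toSubmodule) wellFounded_lt)
    {U | (∀ x ∈ crownBot A B, x ∈ U) ∧ (crownTop A B).toSubmodule ⊔ U.toSubmodule = ⊤}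
    ⟨⊤, fun x _ => LieSubalgebra.mem_top x, by simp⟩
  have hUT : ∀ w ∈ U, w ∈ crownTop A B → w ∈ crownBot A B := by
    intro w hw hwT
    by_contra hx
    obtain ⟨M, hM, hRM, hxM, -⟩ := exists_core_of_not_mem hx
    have hwc : w ∈ core U := inf_le_core (D := crownTop A B) hU
      (fun x hx w _ hwT => hRU _ (hab' x hx w hwT)) hw hwT
    -- Some maximal `M` containing `R` misses the ideal `J = core U ⊓ C`. From `U = J + (U ∩ M)`
    -- follows `C + (U ∩ M) = L`, against the minimality of `U`.
    have hJ := sup_eq_top_of_isCoatom hM (J := core U ⊓ crownTop A B) fun h => hxM (h ⟨hwc, hwT⟩)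
    refine hmin (U ⊓ M) ⟨fun x hx => ⟨hRU x hx, mem_of_mem_core (hRM hx)⟩,
      sup_eq_top_of_forall fun l => ?_⟩ (lt_of_le_of_ne (fun x hx => hx.1) fun h => ?_)
    · obtain ⟨t, ht, u, hu, rfl⟩ := exists_add_eq hU l
      obtain ⟨j, hj, m, hm, rfl⟩ := exists_add_eq hJ u
      refine ⟨t + j, add_mem ht hj.2, m, ⟨?_, hm⟩, add_assoc t j m⟩
      have := sub_mem hu (mem_of_mem_core hj.1)
      rwa [add_sub_cancel_left] at this
    · refine hM.1 (eq_top_of_sup_of_le hJ fun x hx => ?_)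
      exact (h.ge (mem_of_mem_core hx.1 : x ∈ U.toSubmodule)).2
  refine ⟨supIdeal U N, fun h => ?_, ?_, le_inf hN.2.1.le fun x hx => mem_supIdeal_of_mem hx⟩
  · refine hN.2.1.lt.not_ge fun t ht => ?_
    obtain ⟨n, hn, u, hu, rfl⟩ := mem_supIdeal.1 (h ▸ LieSubalgebra.mem_top t : t ∈ supIdeal U N)
    refine add_mem hn (hN.1 (hUT u hu ?_))
    have := sub_mem ht (hN.2.1.le hn)
    rwa [add_sub_cancel_left] at this
  · exact eq_top_iff.2 (hU ▸ sup_le_sup le_rfl (le_supIdeal U N))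

theorem isSupplemented_of_inf_sup [FiniteDimensional F L] (hA : B ⋖ A)
    {X Y N : LieIdeal F L} (hN : N ∈ crownCoatoms A B)
    (hX : Y ⋖ X) (h : X ⊓ N = Y) (h' : X ⊔ N = crownTop A B) : IsSupplementedChiefFactor X Y := by
  obtain ⟨V, hV, hVT, hNV⟩ := exists_supplement_crownCoatom hA hN
  have hNV' : N.toSubmodule ≤ V.toSubmodule := hNV.trans inf_le_right
  have hYN : Y ≤ N := h ▸ inf_le_right
  refine ⟨isChiefFactor_iff.2 hX, V, hV, ?_,
    le_inf hX.le (le_trans (show Y.toSubmodule ≤ N.toSubmodule from hYN) hNV')⟩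
  rw [← h', LieSubmodule.sup_toSubmodule, sup_assoc, sup_eq_right.2 hNV'] at hVT
  exact hVT

variable [FiniteDimensional F L]

/-- Extends separation by `crownCoatoms` from `R` to any `W` in the interval. With `Z` a complement
of `W`, an `N` not containing `Z ⊓ Q` is replaced by `W ⊔ Z ⊓ N`. The factors over both are
`L`-isomorphic to `Z/(Z ⊓ N)`. -/
theorem exists_mem_crownCoatoms_ge (hA : B ⋖ A) {W Q : LieIdeal F L} (hRW : crownBot A B ≤ W)
    (hWQ : W ≤ Q) (hQT : Q ≤ crownTop A B) (h : ¬ Q ≤ W) :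
    ∃ N ∈ crownCoatoms A B, W ≤ N ∧ ¬ Q ≤ N := by
  obtain ⟨Z, hRZ, hWZ, hWZ'⟩ := exists_complement hA hRW (hWQ.trans hQT)
  have hZT : Z ≤ crownTop A B := hWZ ▸ le_sup_right
  have hQ : W ⊔ Z ⊓ Q = Q := by
    rw [← sup_inf_assoc_of_le Z hWQ, hWZ]
    exact inf_eq_right.2 hQT
  obtain ⟨N, hN, hZQN⟩ := exists_mem_crownCoatoms hA (I := Z ⊓ Q) fun hle => h (by
    rw [← hQ]
    exact sup_le le_rfl (hle.trans hRW))
  have hZN : ¬ Z ≤ N := fun hle => hZQN (inf_le_left.trans hle)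
  have hZNT := sup_eq_crownTop hN hZT hZN
  have hinf : Z ⊓ (W ⊔ Z ⊓ N) = Z ⊓ N := by
    rw [inf_comm, sup_comm, sup_inf_assoc_of_le W (inf_le_left : Z ⊓ N ≤ Z), hWZ']
    exact sup_eq_left.2 (le_inf hRZ hN.1)
  have hsup : Z ⊔ (W ⊔ Z ⊓ N) = crownTop A B := by
    rw [sup_left_comm, sup_inf_self, hWZ]
  have hcov : Z ⊓ N ⋖ Z := inf_covBy_of_covBy_sup_right (hZNT.symm ▸ hN.2.1)
  have hcov' : (W ⊔ Z ⊓ N) ⋖ crownTop A B := hsup ▸ covBy_sup_of_inf_eq hcov hinf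
  refine ⟨W ⊔ Z ⊓ N, ⟨hRW.trans le_sup_left, hcov', ?_⟩, le_sup_left, fun hle => hZQN ?_⟩
  · exact LConnected.trans hcov' hN.2.1 hA (Or.inl ((LIso.of_inf_sup hinf hsup).symm.trans
      (LIso.of_inf_sup rfl hZNT))) hN.2.2
  · exact (le_inf inf_le_left (inf_le_right.trans hle)).trans (hinf.le.trans inf_le_right)

/-- A complement in `C` of the socle would, if larger than `R`, contain a minimal ideal over `R`,
which already lies in the socle. -/
theorem factor_crownTop_eq_socle (hA : B ⋖ A) (hRT : crownBot A B ≤ crownTop A B) :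
    factor (crownTop A B) (crownBot A B) = socle F (L ⧸ crownBot A B) := by
  have hle : socle F (L ⧸ crownBot A B) ≤ factor (crownTop A B) (crownBot A B) := by
    refine sSup_le fun I hI => ?_
    rw [← factor_comap I]
    exact factor_mono (le_crownTop_of_covBy hA hRT (isAtom_iff_covBy.1 hI))
  set S := LieIdeal.comap (proj (crownBot A B)) (socle F (L ⧸ crownBot A B)) with hS
  have hST : S ≤ crownTop A B := by
    rw [hS, ← comap_factor hRT]
    exact LieIdeal.comap_mono hle
  obtain ⟨Z, hRZ, hSZ, hSZ'⟩ := exists_complement hA (le_comap_proj _) hST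
  have hZ : Z = crownBot A B := by
    rcases eq_bot_or_exists_atom_le (factor Z (crownBot A B)) with h0 | ⟨P, hP, hPZ⟩
    · rw [← comap_factor hRZ, h0, comap_proj_bot]
    · have h1 := isAtom_iff_covBy.1 hP
      refine absurd ?_ h1.lt.not_ge
      have h2 : LieIdeal.comap (proj (crownBot A B)) P ≤ Z := by
        rw [← comap_factor hRZ]
        exact LieIdeal.comap_mono hPZ
      have h3 : LieIdeal.comap (proj (crownBot A B)) P ≤ S :=
        LieIdeal.comap_mono (show P ≤ socle F _ from le_sSup hP)
      exact (le_inf h3 h2).trans hSZ'.le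
  rw [hZ, sup_eq_left.2 (le_comap_proj _)] at hSZ
  rw [← hSZ, factor_comap]

/-! ### Counting connected factors by dimension. -/

theorem finrank_sup_eq_add {X Y R : LieIdeal F L} (hYX : Y ≤ X) (h : X ⊓ R ≤ Y) :
    Module.finrank F (X ⊔ R : LieIdeal F L) =
      Module.finrank F (Y ⊔ R : LieIdeal F L) + Module.finrank F (factor X Y) := by
  have h0 : X ⊓ R = Y ⊓ R := le_antisymm (le_inf h inf_le_right) (inf_le_inf_right _ hYX)
  have e1 := Submodule.finrank_sup_add_finrank_inf_eq X.toSubmodule R.toSubmodule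
  have e2 := Submodule.finrank_sup_add_finrank_inf_eq Y.toSubmodule R.toSubmodule
  have e3 := finrank_factor_add hYX
  rw [← LieSubmodule.sup_toSubmodule, ← LieSubmodule.inf_toSubmodule] at e1 e2
  rw [h0] at e1
  change Module.finrank F (X ⊔ R : LieIdeal F L) + Module.finrank F (Y ⊓ R : LieIdeal F L) =
    Module.finrank F X + Module.finrank F R at e1
  change Module.finrank F (Y ⊔ R : LieIdeal F L) + Module.finrank F (Y ⊓ R : LieIdeal F L) =
    Module.finrank F Y + Module.finrank F R at e2
  omega

/-- The growth of `(X ∩ C) + R` along a chief factor `X/Y`. -/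
theorem finrank_step (hAB : IsSupplementedChiefFactor A B) {X Y : LieIdeal F L} (hX : Y ⋖ X) :
    ((IsSupplementedChiefFactor X Y ∧ LConnected X Y A B) ∧
      Module.finrank F (X ⊓ crownTop A B ⊔ crownBot A B : LieIdeal F L) =
        Module.finrank F (Y ⊓ crownTop A B ⊔ crownBot A B : LieIdeal F L) +
          Module.finrank F (factor A B)) ∨
    (¬ (IsSupplementedChiefFactor X Y ∧ LConnected X Y A B) ∧
      Module.finrank F (X ⊓ crownTop A B ⊔ crownBot A B : LieIdeal F L) =
        Module.finrank F (Y ⊓ crownTop A B ⊔ crownBot A B : LieIdeal F L)) := by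
  have hA := isChiefFactor_iff.1 hAB.1
  have hRT := crownBot_le_crownTop hAB
  by_cases hP : IsSupplementedChiefFactor X Y ∧ LConnected X Y A B
  · left
    refine ⟨hP, ?_⟩
    obtain ⟨M, hM, hs, hR⟩ := crownBot_le_core hP.1 hP.2
    have hXT : X ≤ crownTop A B := by
      rw [← hP.2.crownTop_eq hX hA]
      exact le_sup_left
    rw [inf_eq_left.2 hXT, inf_eq_left.2 (hX.le.trans hXT), ← hP.2.finrank_eq hX hA]
    refine finrank_sup_eq_add hX.le ?_
    rw [← inf_eq_of_covBy hX hs.le_core hs.not_le_core]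
    exact inf_le_inf_left _ hR
  · right
    refine ⟨hP, ?_⟩
    have hWQ : Y ⊓ crownTop A B ⊔ crownBot A B ≤ X ⊓ crownTop A B ⊔ crownBot A B :=
      sup_le_sup_right (inf_le_inf_right _ hX.le) _
    by_contra hne
    obtain ⟨N, hN, hWN, hQN⟩ := exists_mem_crownCoatoms_ge hA le_sup_right hWQ
      (sup_le inf_le_right hRT) fun hle => hne (by rw [le_antisymm hle hWQ])
    have hYN' := le_sup_left.trans hWN
    have hYT : Y ≤ crownTop A B := le_crownTop_of_inf_le hA hN (by rw [inf_comm]; exact hYN')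
    have hYN : Y ≤ N := (le_inf le_rfl hYT).trans hYN'
    have hXTN : ¬ X ⊓ crownTop A B ≤ N := fun h => hQN (sup_le h hN.1)
    -- `X ⊓ C` is not contained in `Y`, as it is not in `N`. Hence it generates `X` together with `Y
    -- ≤ C`.
    have hXT : X ≤ crownTop A B := by
      have h1 : Y ⊔ X ⊓ crownTop A B = X :=
        (hX.eq_or_eq le_sup_left (sup_le hX.le inf_le_left)).resolve_left fun h =>
          hXTN ((sup_eq_left.1 h).trans hYN)
      rw [← h1]
      exact sup_le hYT inf_le_right
    have hXN : ¬ X ≤ N := fun h => hXTN (inf_le_left.trans h)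
    have hinf := inf_eq_of_covBy hX hYN hXN
    have hsup := sup_eq_crownTop hN hXT hXN
    exact hP ⟨isSupplemented_of_inf_sup hA hN hX hinf hsup,
      lConnected_of_inf_sup hA hN hX hinf hsup⟩

theorem last_eq_add_ncard_mul {n : ℕ} (a : Fin (n + 1) → ℕ) (p : Fin n → Prop) (d : ℕ)
    (h : ∀ i, (p i ∧ a i.succ = a i.castSucc + d) ∨ (¬ p i ∧ a i.succ = a i.castSucc)) :
    a (Fin.last n) = a 0 + {i | p i}.ncard * d := by
  classical
  have key : a (Fin.last n) = a 0 + ∑ i, if p i then d else 0 := by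
    induction n with
    | zero => simp
    | succ n ih =>
      have h1 := ih (fun i => a i.castSucc) (fun i => p i.castSucc) fun i => h i.castSucc
      rw [Fin.sum_univ_castSucc, ← add_assoc]
      change a (Fin.last n).castSucc = a 0 + _ at h1
      rw [← h1]
      rcases h (Fin.last n) with ⟨hp, e⟩ | ⟨hp, e⟩
      · rw [if_pos hp, ← e]; rfl
      · rw [if_neg hp, add_zero, ← e]; rfl
  rw [key, ← Finset.sum_filter, Finset.sum_const, smul_eq_mul, Set.ncard_eq_toFinset_card']
  congr 3
  ext i
  simp

theorem finrank_iSup_of_iSupIndep {r d : ℕ} {f : Fin r → LieIdeal F L} (hf : iSupIndep f)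
    (hd : ∀ i, Module.finrank F (f i) = d) :
    Module.finrank F (⨆ i, f i : LieIdeal F L) = r * d := by
  classical
  have key : ∀ s : Finset (Fin r),
      Module.finrank F (s.sup f : LieIdeal F L) = s.card * d := by
    intro s
    induction s using Finset.induction_on with
    | empty =>
      rw [Finset.sup_empty, Finset.card_empty, zero_mul]
      exact finrank_bot F L
    | insert i s hi ih =>
      have hdis : Disjoint (f i) (s.sup f) :=
        hf.supIndep' (insert i s) (Finset.subset_insert i s) (Finset.mem_insert_self i s) hi
      have e := Submodule.finrank_sup_add_finrank_inf_eq (f i).toSubmodule (s.sup f).toSubmodule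
      rw [← LieSubmodule.sup_toSubmodule, ← LieSubmodule.inf_toSubmodule, hdis.eq_bot] at e
      rw [LieSubmodule.bot_toSubmodule, finrank_bot, add_zero] at e
      rw [Finset.sup_insert, Finset.card_insert_of_notMem hi, add_mul, one_mul, ← ih, add_comm,
        ← hd i]
      exact e
  have h := key Finset.univ
  rw [Finset.sup_univ_eq_iSup, Finset.card_univ, Fintype.card_fin] at h
  exact h

/-- The socle is generated by atoms, so an independent family of atoms already spans it. The
ascending chain condition makes that family finite. -/
theorem exists_iSupIndep_isAtom (F L : Type*) [Field F] [LieRing L] [LieAlgebra F L]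
    [FiniteDimensional F L] :
    ∃ (r : ℕ) (f : Fin r → LieIdeal F L), iSupIndep f ∧ ⨆ i, f i = socle F L ∧
      ∀ i, IsAtom (f i) := by
  have : IsCompactlyGenerated (LieIdeal F L) :=
    CompleteLattice.isCompactlyGenerated_of_wellFoundedGT
  obtain ⟨s, hs, hsup, hat⟩ := exists_sSupIndep_of_sSup_atoms (socle F L)
    (le_antisymm (sSup_le fun _ h => h.1) (sSup_le fun I hI => le_sSup ⟨le_sSup hI, hI⟩))
  have hfin : Finite s := (WellFoundedGT.finite_of_sSupIndep hs).to_subtype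
  let e := (Finite.equivFin s).symm
  refine ⟨_, fun i => (e i : LieIdeal F L), ((sSupIndep_iff s).1 hs).comp e.injective, ?_,
    fun i => hat (e i).2⟩
  rw [← hsup, sSup_eq_iSup']
  exact e.iSup_comp (g := fun x : s => (x : LieIdeal F L))

theorem exists_decomposition (hAB : IsSupplementedChiefFactor A B) :
    ∃ (r : ℕ) (T : Fin r → LieIdeal F L),
      (∀ i, crownBot A B ≤ T i ∧ IsSupplementedChiefFactor (T i) (crownBot A B) ∧
        LConnected (T i) (crownBot A B) A B) ∧
      iSupIndep (fun i => factor (T i) (crownBot A B)) ∧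
      (⨆ i, factor (T i) (crownBot A B)) = factor (crownTop A B) (crownBot A B) ∧
      ∀ (n : ℕ) (S : Fin (n + 1) → LieIdeal F L), IsChiefSeries n S →
        {i : Fin n | IsSupplementedChiefFactor (S i.succ) (S i.castSucc) ∧
          LConnected (S i.succ) (S i.castSucc) A B}.ncard = r := by
  have hA := isChiefFactor_iff.1 hAB.1
  have hRT := crownBot_le_crownTop hAB
  have hsoc := factor_crownTop_eq_socle hA hRT
  obtain ⟨r, f, hind, hiSup, hat⟩ := exists_iSupIndep_isAtom F (L ⧸ crownBot A B)
  rw [← hsoc] at hiSup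
  have hcov : ∀ i, crownBot A B ⋖ LieIdeal.comap (proj (crownBot A B)) (f i) :=
    fun i => isAtom_iff_covBy.1 (hat i)
  have hprop := fun i => isSupplementedChiefFactor_of_covBy hA hRT (hcov i)
  refine ⟨r, fun i => LieIdeal.comap (proj (crownBot A B)) (f i),
    fun i => ⟨(hcov i).le, hprop i⟩, ?_, ?_, fun n S hS => ?_⟩
  · simpa only [factor_comap] using hind
  · simpa only [factor_comap] using hiSup
  have hd := finrank_iSup_of_iSupIndep hind (d := Module.finrank F (factor A B)) fun i => by
    rw [← (hprop i).2.finrank_eq (hcov i) hA, factor_comap]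
  rw [hiSup] at hd
  have hT := finrank_factor_add hRT
  have hcount := last_eq_add_ncard_mul
    (fun i => Module.finrank F (S i ⊓ crownTop A B ⊔ crownBot A B : LieIdeal F L))
    (fun i => IsSupplementedChiefFactor (S i.succ) (S i.castSucc) ∧
      LConnected (S i.succ) (S i.castSucc) A B) (Module.finrank F (factor A B))
    fun i => finrank_step hAB (isChiefFactor_iff.1 (hS.2.2 i))
  have e0 : S 0 ⊓ crownTop A B ⊔ crownBot A B = crownBot A B := by
    rw [hS.1, bot_inf_eq, bot_sup_eq]
  have e1 : S (Fin.last n) ⊓ crownTop A B ⊔ crownBot A B = crownTop A B := by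
    rw [hS.2.1, top_inf_eq, sup_eq_left.2 hRT]
  rw [e0, e1] at hcount
  have hpos : 0 < Module.finrank F (factor A B) := by
    have : Nontrivial (factor A B) := (LieSubmodule.nontrivial_iff_ne_bot F _ _).2 hAB.1.2.1
    exact Module.finrank_pos
  -- `dim C - dim R` is `dim A/B` times the number of connected factors in the series, and also `r`
  -- times `dim A/B`.
  refine Nat.eq_of_mul_eq_mul_right hpos ?_
  omega

theorem not_lConnected (hAB : IsSupplementedChiefFactor A B) {X Y : LieIdeal F L}
    (hX : IsSupplementedChiefFactor X Y) (h : crownTop A B ≤ Y ∨ X ≤ crownBot A B) :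
    ¬ LConnected X Y A B := by
  intro hc
  rcases h with h | h
  · have hX' := isChiefFactor_iff.1 hX.1
    have h1 := hc.crownTop_eq hX' (isChiefFactor_iff.1 hAB.1)
    exact hX'.lt.not_ge ((le_sup_left : X ≤ crownTop X Y).trans (h1.le.trans h))
  · exact not_le_crownBot hX hc h

end

end LieCrown

theorem theoremt {F L : Type*} [Field F] [LieRing L] [LieAlgebra F L] [FiniteDimensional F L]
    (A B : LieIdeal F L) (hAB : LieCrown.IsSupplementedChiefFactor A B)
    (C R : LieIdeal F L) (hC : C = LieCrown.crownTop A B) (hR : R = LieCrown.crownBot A B) :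
    -- `C/R = Soc(L/R)`
    R ≤ C ∧ LieCrown.factor C R = LieCrown.socle F (L ⧸ R) ∧
    -- every minimal ideal of `L/R` is a supplemented chief factor `L`-connected to `A/B`
    (∀ I : LieIdeal F (L ⧸ R), IsAtom I →
      LieCrown.IsSupplementedChiefFactor (LieIdeal.comap (LieCrown.proj R) I) R ∧
      LieCrown.LConnected (LieIdeal.comap (LieCrown.proj R) I) R A B) ∧
    -- no supplemented chief factor above `C` or below `R` is `L`-connected to `A/B`
    (∀ X Y : LieIdeal F L, LieCrown.IsSupplementedChiefFactor X Y → (C ≤ Y ∨ X ≤ R) →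
      ¬ LieCrown.LConnected X Y A B) ∧
    -- the decomposition of `C/R`, and the number of its summands
    (∃ (r : ℕ) (T : Fin r → LieIdeal F L),
      (∀ i, R ≤ T i ∧ LieCrown.IsSupplementedChiefFactor (T i) R ∧
        LieCrown.LConnected (T i) R A B) ∧
      iSupIndep (fun i => LieCrown.factor (T i) R) ∧
      (⨆ i, LieCrown.factor (T i) R) = LieCrown.factor C R ∧
      ∀ (n : ℕ) (S : Fin (n + 1) → LieIdeal F L), LieCrown.IsChiefSeries n S →
        {i : Fin n | LieCrown.IsSupplementedChiefFactor (S i.succ) (S i.castSucc) ∧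
          LieCrown.LConnected (S i.succ) (S i.castSucc) A B}.ncard = r) ∧
    -- `φ(L/R) = 0`
    LieCrown.frattini F (L ⧸ R) = ⊥ := by
  subst hC hR
  have hA := LieCrown.isChiefFactor_iff.1 hAB.1
  have hRT := LieCrown.crownBot_le_crownTop hAB
  exact ⟨hRT, LieCrown.factor_crownTop_eq_socle hA hRT,
    fun I hI => LieCrown.isSupplementedChiefFactor_of_covBy hA hRT
      (LieCrown.isAtom_iff_covBy.1 hI),
    fun X Y hX h => LieCrown.not_lConnected hAB hX h, LieCrown.exists_decomposition hAB,
    LieCrown.frattini_quotient_crownBot⟩
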